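/- For an even integer $n$, let $G_{n,1}$ denote a $1$-regular graph (that is, a perfect matching) on the vertex set $[n]=\{1,\dots,n\}$, chosen uniformly at random among all $1$-regular graphs on $[n]$. A graph on $n$ vertices is called pancyclic if it contains a cycle of length $k$ for every integer $k$ with $3\le k\le n$. Theorem 1.3. Let $(n_i)_{i\in\mathbb{N}}$ be a sequence of even non-negative integers with $n_i\to\infty$, and let $(\alpha_i)_{i\in\mathbb{N}}$ be a sequence of non-negative reals with $\alpha_i=\omega\big((\log n_i/n_i)^{1/4}\big)$ as $i\to\infty$, that is, $(\log n_i/n_i)^{1/4}=o(\alpha_i)$. For each $i$, let $H_i$ be a graph with vertex set $[n_i]$ and minimum degree $\delta(H_i)\ge\alpha_i n_i$ that contains a matching $M_i$, and suppose that the number of vertices of $H_i$ not covered by $M_i$ is $o(\alpha_i^2 n_i)$ as $i\to\infty$. Then, asymptotically almost surely, $H_i\cup G_{n_i,1}$ is pancyclic, that is, $$\lim_{i\to\infty}\mathbb{P}\big[H_i\cup G_{n_i,1}\text{ is pancyclic}\big]=1.$$ -/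

import Mathlib

open Filter Asymptotics ProbabilityTheory MeasureTheory

/-- The uniform probability measure on the `d`-regular simple graphs with vertex set `Fin n`,
that is, the law of the random `d`-regular graph `G_{n,d}`. -/
noncomputable def randomRegularGraph (n d : ℕ) : Measure (SimpleGraph (Fin n)) :=
  open Classical in uniformOn {G : SimpleGraph (Fin n) | G.IsRegularOfDegree d}

/-- A finite graph is pancyclic if it contains a cycle of every length between `3` and its number
of vertices. -/
def IsPancyclic {V : Type*} [Fintype V] (G : SimpleGraph V) : Prop :=
  ∀ k : ℕ, 3 ≤ k → k ≤ Fintype.card V →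
    ∃ (v : V) (c : G.Walk v v), c.IsCycle ∧ c.length = k

open Classical in
/-- The law of `G_{n,d}` is given by counting: the probability of an event is the proportion of
`d`-regular graphs on `Fin n` that belong to it. -/
theorem randomRegularGraph_apply (n d : ℕ) (S : Set (SimpleGraph (Fin n))) :
    randomRegularGraph n d S =
      (Finset.card {G : SimpleGraph (Fin n) | G.IsRegularOfDegree d ∧ G ∈ S} : ENNReal) /
        Finset.card {G : SimpleGraph (Fin n) | G.IsRegularOfDegree d} := by
  have hms : MeasurableSingletonClass (SimpleGraph (Fin n)) := by
    refine ⟨fun G => ?_⟩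
    have h : ({G} : Set (SimpleGraph (Fin n))) =
        (SimpleGraph.edgeSet : SimpleGraph (Fin n) → Set (Sym2 (Fin n))) ⁻¹' {G.edgeSet} := by
      ext G'
      simp
    rw [h]
    exact SimpleGraph.measurable_edgeSet (measurableSet_singleton _)
  rw [randomRegularGraph]
  have h := uniformOn_apply_finset
    (s := ({G | G.IsRegularOfDegree d} : Finset (SimpleGraph (Fin n)))) (t := S.toFinset)
  simp only [Finset.coe_filter, Set.coe_toFinset, Finset.mem_univ, true_and] at h
  rw [h]
  congr 3
  ext G
  simp

/-!
Since `H` has a matching covering almost all vertices, extend it to a pairing `τ` of all vertices,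
and let `γ` be the random matching, both seen as fixed-point-free involutions. The union of `τ` and
`γ` consists of alternating cycles, whose halves are the orbits of `τ * γ`. Opening these cycles
gives an ordering of the edges of `γ` in which the end of an edge is usually joined to the start of
the next one by an edge of `H`. The exceptions, the bad links, come from the alternating cycles and
from the pairs of `τ` that are not edges of `H`.

*Few bad links.* A switching argument shows that an alternating cycle through a given vertex closes
after exactly `j` steps with probability at most `1 / (n - 2 j)`, so on average only `O(√n)`
vertices lie in orbits of length at most `√n` (`sum_card_shortOrbitVertices_le`). The longer orbits give only
`O(√n)` alternating cycles (`exists_ordering`). Both bounds are `o(α² n)`.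

*Many connections.* The law of `γ` is invariant under permuting the pairs of `τ`, and this does not
change the shape of the union of `τ` and `γ` (`sum_card_conj_mem`). Fix an orientation of the pairs
of `τ` for which every neighbourhood in `H` contains many starts and many ends
(`IsMatchingInvolution.exists_balanced_labelling`). For vertices `x` and `y`, and for a block of
linearly many edges of the ordering, the expected number of edges `(u, v)` of the block with
`u ∈ N(x)` and `v ∈ N(y)` is then of order `α² n` under a random permutation of the pairs. This
number changes by at most `8` under a transposition, hence it is concentrated
(`card_perm_le_sub_le`, `card_pairCount_le`), and as `α² n` exceeds `√(n log n)` by a large factor,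
a union bound over `x` and `y` applies.

*Cycles.* Given such an ordering, let `E` be the first third of its edges and let `c` be an index in
the middle third whose link is good (`hasCyclicList_of_ordering`). A window of edges starting at `c`
is closed up to a cycle by replacing each of its bad links, and the link from its end to its start,
by a suitable edge from `E`. Lengthening the window by one edge lengthens the cycle by `2` or `4`,
and the lengths in between are obtained by dropping up to three vertices at the start. Longer cycles
arise from the window of all edges from `c` on: the wanted number of remaining vertices forms few
paths, and each of these is inserted into its own edge from the last third of the ordering.
-/

/-! ### Concentration on the symmetric group -/

open Equiv in
theorem decomposeFin_symm_eq_swap_mul {n : ℕ} (p : Fin (n + 1)) (σ : Perm (Fin n)) :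
    Perm.decomposeFin.symm (p, σ) = swap 0 p * Perm.decomposeFin.symm (0, σ) := by
  ext x
  refine Fin.cases ?_ (fun y => ?_) x <;> simp

open Equiv in
theorem decomposeFin_symm_swap_mul {n : ℕ} (i j : Fin n) (p : Fin (n + 1)) (σ : Perm (Fin n)) :
    Perm.decomposeFin.symm (p, swap i j * σ) =
      swap (swap 0 p i.succ) (swap 0 p j.succ) * Perm.decomposeFin.symm (p, σ) := by
  have h0 : Perm.decomposeFin.symm (0, swap i j * σ) =
      swap i.succ j.succ * Perm.decomposeFin.symm (0, σ) := by
    apply Equiv.ext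
    intro x
    refine Fin.cases ?_ (fun y => ?_) x
    · simp [swap_apply_of_ne_of_ne (Fin.succ_ne_zero i).symm (Fin.succ_ne_zero j).symm]
    · simp only [Perm.decomposeFin_symm_apply_succ, swap_self, refl_apply, Perm.mul_apply]
      exact (Fin.succ_injective n).map_swap ..
  rw [decomposeFin_symm_eq_swap_mul, h0, decomposeFin_symm_eq_swap_mul p σ, ← mul_assoc,
    ← mul_assoc, Equiv.mul_swap_eq_swap_mul]

/-- Hoeffding's bound for the exponential moment of a centred function on a finite type, in
unnormalised form. -/
theorem sum_exp_le_of_abs_le {ι : Type*} [Fintype ι] (g : ι → ℝ) (d t : ℝ) (hd : 0 ≤ d)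
    (hg : ∀ i, |g i| ≤ d) (hsum : ∑ i, g i = 0) :
    ∑ i, Real.exp (t * g i) ≤ Fintype.card ι * Real.exp (t ^ 2 * d ^ 2 / 2) := by
  rcases hd.eq_or_lt with rfl | hd
  · have : ∀ i, g i = 0 := fun i => abs_nonpos_iff.1 (hg i)
    simp [this]
  have h1 : ∀ i, Real.exp (t * g i) ≤
      Real.cosh (t * d) + g i * (Real.sinh (t * d) / d) := by
    intro i
    have h := Real.exp_mul_le_cosh_add_mul_sinh (t := g i / d)
      (by rw [abs_div, abs_of_pos hd]; exact (div_le_one hd).2 (hg i)) (t * d)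
    convert h using 2
    · field_simp
    · ring
  calc ∑ i, Real.exp (t * g i)
      ≤ ∑ i, (Real.cosh (t * d) + g i * (Real.sinh (t * d) / d)) :=
        Finset.sum_le_sum fun i _ => h1 i
    _ = Fintype.card ι * Real.cosh (t * d) := by
        rw [Finset.sum_add_distrib, ← Finset.sum_mul, hsum]
        simp
    _ ≤ _ := by
        gcongr
        refine (Real.cosh_le_exp_half_sq _).trans_eq ?_
        congr 1
        ring

open Equiv in
/-- A function on the symmetric group that changes by at most `c` under left multiplication by a
transposition has a sub-Gaussian exponential moment around its mean. The proof exposes the value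
at `0` and applies induction to the remaining permutation. -/
theorem sum_exp_perm_le : ∀ (m : ℕ) (f : Perm (Fin m) → ℝ) (c t : ℝ) (_ : 0 ≤ c)
    (_ : ∀ i j π, |f (swap i j * π) - f π| ≤ c),
    ∑ π, Real.exp (t * (f π - (∑ σ, f σ) / m.factorial)) ≤
      m.factorial * Real.exp (m * (t ^ 2 * (2 * c) ^ 2 / 2))
  | 0, f, c, t, hc, hf => by
      simp
  | m + 1, f, c, t, hc, hf => by
      set μ : ℝ := (∑ σ, f σ) / (m + 1).factorial with hμ
      let F : Fin (m + 1) → Perm (Fin m) → ℝ := fun p σ => f (Perm.decomposeFin.symm (p, σ))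
      let g : Fin (m + 1) → ℝ := fun p => (∑ σ, F p σ) / m.factorial
      have hm0 : (0 : ℝ) < m.factorial := by exact_mod_cast m.factorial_pos
      have hsum : ∀ φ : Perm (Fin (m + 1)) → ℝ,
          ∑ π, φ π = ∑ p, ∑ σ, φ (Perm.decomposeFin.symm (p, σ)) := by
        intro φ
        rw [← Perm.decomposeFin.symm.sum_comp, Fintype.sum_prod_type]
      have hF : ∀ p i j σ, |F p (swap i j * σ) - F p σ| ≤ c := by
        intro p i j σ
        simp only [F, decomposeFin_symm_swap_mul]
        exact hf _ _ _
      have hF0 : ∀ p σ, |F p σ - F 0 σ| ≤ c := by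
        intro p σ
        simp only [F]
        rw [decomposeFin_symm_eq_swap_mul p]
        exact hf _ _ _
      have hg0 : ∀ p, |g p - g 0| ≤ c := by
        intro p
        simp only [g]
        rw [← sub_div, ← Finset.sum_sub_distrib, abs_div, abs_of_pos hm0, div_le_iff₀ hm0]
        refine (Finset.abs_sum_le_sum_abs _ _).trans
          ((Finset.sum_le_sum fun σ _ => hF0 p σ).trans_eq ?_)
        simp [Fintype.card_perm, mul_comm]
      have hgμ : ∑ p, g p = (m + 1) * μ := by
        simp only [g]
        rw [← Finset.sum_div, hμ, hsum f, Nat.factorial_succ]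
        push_cast
        field_simp
        rfl
      have hm1 : (0 : ℝ) < (m : ℝ) + 1 := by positivity
      have hμ0 : |g 0 - μ| ≤ c := by
        have : (m + 1) * (g 0 - μ) = ∑ p, (g 0 - g p) := by
          rw [Finset.sum_sub_distrib, hgμ]; simp; ring
        have h2 : (m + 1) * |g 0 - μ| ≤ (m + 1) * c := by
          rw [← abs_of_pos hm1, ← abs_mul, this]
          refine (Finset.abs_sum_le_sum_abs _ _).trans ((Finset.sum_le_sum fun p _ => ?_).trans_eq
            (b := ∑ p : Fin (m + 1), c) ?_)
          · rw [abs_sub_comm]; exact hg0 p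
          · simp [abs_of_pos hm1]
        exact le_of_mul_le_mul_left h2 hm1
      have hg : ∀ p, |g p - μ| ≤ 2 * c := by
        intro p
        have := abs_sub_le (g p) (g 0) μ
        linarith [hg0 p]
      have key := sum_exp_le_of_abs_le (fun p => g p - μ) (2 * c) t (by positivity) hg
        (by rw [Finset.sum_sub_distrib, hgμ]; simp)
      rw [hsum]
      calc ∑ p, ∑ σ, Real.exp (t * (F p σ - μ))
          = ∑ p, Real.exp (t * (g p - μ)) * ∑ σ, Real.exp (t * (F p σ - g p)) := by
            refine Finset.sum_congr rfl fun p _ => ?_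
            rw [Finset.mul_sum]
            refine Finset.sum_congr rfl fun σ _ => ?_
            rw [← Real.exp_add]
            congr 1
            ring
        _ ≤ ∑ p, Real.exp (t * (g p - μ)) *
              (m.factorial * Real.exp (m * (t ^ 2 * (2 * c) ^ 2 / 2))) := by
            gcongr with p
            exact sum_exp_perm_le m (F p) c t hc (hF p)
        _ = (∑ p, Real.exp (t * (g p - μ))) *
              (m.factorial * Real.exp (m * (t ^ 2 * (2 * c) ^ 2 / 2))) := by
            rw [Finset.sum_mul]
        _ ≤ (Fintype.card (Fin (m + 1)) * Real.exp (t ^ 2 * (2 * c) ^ 2 / 2)) *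
              (m.factorial * Real.exp (m * (t ^ 2 * (2 * c) ^ 2 / 2))) := by
            gcongr
        _ = _ := by
            rw [Nat.factorial_succ]
            push_cast
            rw [add_one_mul (m : ℝ) (t ^ 2 * (2 * c) ^ 2 / 2), Real.exp_add, Fintype.card_fin]
            push_cast
            ring

open Equiv in
/-- The lower tail of a function on the symmetric group that changes by at most `c` under left
multiplication by a transposition. -/
theorem card_perm_le_sub_le {m : ℕ} (hm : 0 < m) (f : Perm (Fin m) → ℝ) (c s : ℝ) (hc : 0 < c)
    (hs : 0 ≤ s) (hf : ∀ i j π, |f (swap i j * π) - f π| ≤ c) :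
    (({π | f π ≤ (∑ σ, f σ) / m.factorial - s} : Finset (Perm (Fin m))).card : ℝ) ≤
      m.factorial * Real.exp (-(s ^ 2 / (8 * m * c ^ 2))) := by
  have hm' : (0 : ℝ) < m := by exact_mod_cast hm
  set μ : ℝ := (∑ σ, f σ) / m.factorial with hμ
  -- the minimizer of the bound from Markov's inequality
  set t : ℝ := -(s / (m * (2 * c) ^ 2)) with ht
  set S : Finset (Perm (Fin m)) := {π | f π ≤ μ - s}
  have ht0 : t ≤ 0 := by rw [ht]; simp only [Left.neg_nonpos_iff]; positivity
  have h1 : (S.card : ℝ) * Real.exp (t * (-s)) ≤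
      m.factorial * Real.exp (m * (t ^ 2 * (2 * c) ^ 2 / 2)) := by
    refine le_trans ?_ (sum_exp_perm_le m f c t hc.le hf)
    rw [← nsmul_eq_mul, ← Finset.sum_const]
    refine (Finset.sum_le_sum (fun π hπ => ?_)).trans
      (Finset.sum_le_sum_of_subset_of_nonneg (Finset.subset_univ S) fun _ _ _ => (Real.exp_pos _).le)
    have : f π ≤ μ - s := (Finset.mem_filter.1 hπ).2
    apply Real.exp_le_exp.2
    nlinarith
  have h2 : (S.card : ℝ) ≤ m.factorial * Real.exp (m * (t ^ 2 * (2 * c) ^ 2 / 2)) *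
      Real.exp (-(t * (-s))) := by
    rw [Real.exp_neg, ← div_eq_mul_inv, le_div_iff₀ (Real.exp_pos _)]
    exact h1
  refine h2.trans_eq ?_
  rw [mul_assoc, ← Real.exp_add]
  congr 2
  rw [ht]
  field_simp
  ring

/-! ### Matching involutions -/

/-- A permutation is a matching involution if it is an involution without fixed points. Such
permutations of `V` encode the perfect matchings (1-regular graphs) on `V`: each vertex is sent to
its partner. -/
def IsMatchingInvolution {V : Type*} (γ : Equiv.Perm V) : Prop :=
  ∀ v, γ (γ v) = v ∧ γ v ≠ v

/-! ### Switchings of a matching -/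

section Switching

variable {V : Type*} {γ τ : Equiv.Perm V}

/-- The two orbits of `τ * γ` in one alternating cycle of `τ` and `γ` are different: the orbit of
`u` does not contain `τ u`. -/
theorem IsMatchingInvolution.pow_mul_apply_ne (hτ : IsMatchingInvolution τ)
    (hγ : IsMatchingInvolution γ) : ∀ (k : ℕ) (u : V), ((τ * γ) ^ k) u ≠ τ u
  | 0, u => by simpa using (hτ u).2.symm
  | 1, u => by simpa using (hγ u).2
  | k + 2, u => by
      intro h
      rw [pow_succ' (τ * γ) (k + 1), pow_succ] at h
      simp only [Equiv.Perm.mul_apply, EmbeddingLike.apply_eq_iff_eq] at h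
      have h2 := congrArg γ h
      rw [(hγ _).1] at h2
      refine hτ.pow_mul_apply_ne hγ k (τ (γ u)) ?_
      rw [(hτ _).1]
      exact h2

theorem IsMatchingInvolution.conj (hγ : IsMatchingInvolution γ) (s : Equiv.Perm V) :
    IsMatchingInvolution (s * γ * s⁻¹) := by
  intro v
  constructor
  · simp [(hγ _).1]
  · intro h
    apply (hγ (s⁻¹ v)).2
    simp only [Equiv.Perm.mul_apply] at h
    rw [Equiv.Perm.eq_inv_iff_eq]
    exact h

/-- The vertices of the alternating cycle of `τ` and `γ` through `v`, when the orbit of `v` under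
`τ * γ` has length `j`. -/
def alternatingCycle [DecidableEq V] (τ γ : Equiv.Perm V) (v : V) (j : ℕ) : Finset V :=
  (Finset.range j).image (fun i => ((τ * γ) ^ i) v) ∪
    (Finset.range j).image (fun i => τ (((τ * γ) ^ i) v))

theorem card_alternatingCycle_le [DecidableEq V] (τ γ : Equiv.Perm V) (v : V) (j : ℕ) :
    (alternatingCycle τ γ v j).card ≤ 2 * j := by
  refine (Finset.card_union_le _ _).trans ?_
  have h1 := Finset.card_image_le (s := Finset.range j) (f := fun i => ((τ * γ) ^ i) v)
  have h2 := Finset.card_image_le (s := Finset.range j) (f := fun i => τ (((τ * γ) ^ i) v))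
  simp only [Finset.card_range] at h1 h2
  omega

theorem pow_mem_alternatingCycle [DecidableEq V] {v : V} {j i : ℕ} (hi : i < j) :
    ((τ * γ) ^ i) v ∈ alternatingCycle τ γ v j :=
  Finset.mem_union_left _ (Finset.mem_image_of_mem _ (Finset.mem_range.2 hi))

theorem apply_pow_mem_alternatingCycle [DecidableEq V] {v : V} {j i : ℕ} (hi : i < j) :
    τ (((τ * γ) ^ i) v) ∈ alternatingCycle τ γ v j :=
  Finset.mem_union_right _ (Finset.mem_image_of_mem _ (Finset.mem_range.2 hi))

/-- If the alternating cycle through `v` has length `j`, exchanging `τ v` with a vertex `z` outside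
that cycle opens it up, and `z` can be read off from the new matching: after `j` steps from `v`, the
alternating path now arrives at `τ z`. -/
theorem pow_mul_switch_apply [DecidableEq V] (hτ : IsMatchingInvolution τ)
    (hγ : IsMatchingInvolution γ) {v z : V} {j : ℕ} (hj : 0 < j)
    (hper : ((τ * γ) ^ j) v = v) (hmin : ∀ i, 0 < i → i < j → ((τ * γ) ^ i) v ≠ v)
    (hz : z ∉ alternatingCycle τ γ v j) :
    ((τ * (Equiv.swap (τ v) z * γ * (Equiv.swap (τ v) z)⁻¹)) ^ j) v = τ z := by
  set s := Equiv.swap (τ v) z with hs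
  have hγρ : ∀ u, γ u = τ ((τ * γ) u) := fun u => by simp [(hτ _).1]
  have hfix : ∀ i, i < j → s (((τ * γ) ^ i) v) = ((τ * γ) ^ i) v := by
    intro i hi
    apply Equiv.swap_apply_of_ne_of_ne
    · exact hτ.pow_mul_apply_ne hγ i v
    · rintro rfl
      exact hz (pow_mem_alternatingCycle hi)
  have hstep : ∀ i, i < j → ((τ * (s * γ * s⁻¹)) ^ i) v = ((τ * γ) ^ i) v := by
    intro i
    induction i with
    | zero => simp
    | succ i ih =>
      intro hi
      rw [pow_succ', Equiv.Perm.mul_apply, ih (by omega), pow_succ' (τ * γ)]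
      simp only [Equiv.Perm.mul_apply, EmbeddingLike.apply_eq_iff_eq]
      rw [hs, Equiv.swap_inv, ← hs, hfix i (by omega), hγρ, ← Equiv.Perm.mul_apply (τ * γ),
        ← pow_succ']
      apply Equiv.swap_apply_of_ne_of_ne
      · intro h
        exact hmin (i + 1) (by omega) hi (τ.injective h)
      · intro h
        exact hz (h ▸ apply_pow_mem_alternatingCycle hi)
  obtain ⟨i, rfl⟩ : ∃ i, j = i + 1 := ⟨j - 1, by omega⟩
  rw [pow_succ', Equiv.Perm.mul_apply, hstep i (by omega)]
  simp only [Equiv.Perm.mul_apply, EmbeddingLike.apply_eq_iff_eq]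
  rw [hs, Equiv.swap_inv, ← hs, hfix i (by omega), hγρ, ← Equiv.Perm.mul_apply (τ * γ),
    ← pow_succ', hper, hs, Equiv.swap_apply_left]

end Switching

/-! ### Matchings with few short orbits -/

section Counting

open Classical in
/-- The finite set of all matching involutions. -/
noncomputable def matchingInvolutions (V : Type*) [Fintype V] : Finset (Equiv.Perm V) :=
  {γ | IsMatchingInvolution γ}

theorem mem_matchingInvolutions {V : Type*} [Fintype V] {γ : Equiv.Perm V} :
    γ ∈ matchingInvolutions V ↔ IsMatchingInvolution γ := by
  simp [matchingInvolutions]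

variable {V : Type*} [Fintype V] {τ : Equiv.Perm V}

open Classical in
/-- Only a fraction `1 / (n - 2 j)` of the matching involutions close the alternating cycle through
`v` after exactly `j` steps: every such involution has `n - 2 j` switchings, and the switched
involution determines the original one. -/
theorem card_minimal_period_mul_le (hτ : IsMatchingInvolution τ) (v : V) {j : ℕ} (hj : 0 < j) :
    ((matchingInvolutions V).filter (fun γ => ((τ * γ) ^ j) v = v ∧
      ∀ i, 0 < i → i < j → ((τ * γ) ^ i) v ≠ v)).card * (Fintype.card V - 2 * j) ≤
      (matchingInvolutions V).card := by
  set B := (matchingInvolutions V).filter (fun γ => ((τ * γ) ^ j) v = v ∧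
      ∀ i, 0 < i → i < j → ((τ * γ) ^ i) v ≠ v) with hB
  have h1 : B.card * (Fintype.card V - 2 * j) ≤
      (B.sigma fun γ => (alternatingCycle τ γ v j)ᶜ).card := by
    rw [Finset.card_sigma, ← smul_eq_mul, ← Finset.sum_const]
    refine Finset.sum_le_sum fun γ _ => ?_
    rw [Finset.card_compl]
    have := card_alternatingCycle_le τ γ v j
    omega
  refine h1.trans ?_
  have key : ∀ p ∈ (B.sigma fun γ => (alternatingCycle τ γ v j)ᶜ),
      IsMatchingInvolution p.1 ∧ ((τ * (Equiv.swap (τ v) p.2 * p.1 * (Equiv.swap (τ v) p.2)⁻¹)) ^ j)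
        v = τ p.2 := by
    rintro ⟨γ, z⟩ hp
    simp only [hB, Finset.mem_sigma, Finset.mem_filter, mem_matchingInvolutions,
      Finset.mem_compl] at hp
    obtain ⟨⟨hγ, h1, h2⟩, hz⟩ := hp
    exact ⟨hγ, pow_mul_switch_apply hτ hγ hj h1 h2 hz⟩
  refine Finset.card_le_card_of_injOn
    (fun p => Equiv.swap (τ v) p.2 * p.1 * (Equiv.swap (τ v) p.2)⁻¹) ?_ ?_
  · intro p hp
    exact mem_matchingInvolutions.2 ((key p hp).1.conj _)
  · intro p hp q hq h
    have hp' := (key p hp).2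
    have hq' := (key q hq).2
    simp only at h
    rw [h, hq'] at hp'
    have hz : q.2 = p.2 := τ.injective hp'
    rw [hz] at h
    have h3 : p.1 = q.1 := mul_left_cancel (mul_right_cancel h)
    exact Sigma.ext h3 (heq_of_eq hz.symm)

open Classical in
/-- The vertices whose orbit under `τ * γ` has length at most `J`. -/
noncomputable def shortOrbitVertices (τ γ : Equiv.Perm V) (J : ℕ) : Finset V :=
  {v | ∃ j, 0 < j ∧ j ≤ J ∧ ((τ * γ) ^ j) v = v}

theorem mem_shortOrbitVertices {γ : Equiv.Perm V} {J : ℕ} {v : V} :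
    v ∈ shortOrbitVertices τ γ J ↔ ∃ j, 0 < j ∧ j ≤ J ∧ ((τ * γ) ^ j) v = v := by
  simp [shortOrbitVertices]

open Classical in
theorem card_mem_shortOrbitVertices_mul_le (hτ : IsMatchingInvolution τ) (v : V) {J : ℕ} :
    ((matchingInvolutions V).filter (fun γ => v ∈ shortOrbitVertices τ γ J)).card *
      (Fintype.card V - 2 * J) ≤ J * (matchingInvolutions V).card := by
  have hsub : (matchingInvolutions V).filter (fun γ => v ∈ shortOrbitVertices τ γ J) ⊆
      (Finset.Icc 1 J).biUnion fun j => (matchingInvolutions V).filter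
        (fun γ => ((τ * γ) ^ j) v = v ∧ ∀ i, 0 < i → i < j → ((τ * γ) ^ i) v ≠ v) := by
    intro γ hγ
    simp only [Finset.mem_filter, mem_shortOrbitVertices] at hγ
    obtain ⟨hγ, hex⟩ := hγ
    have hspec := Nat.find_spec hex
    simp only [Finset.mem_biUnion, Finset.mem_Icc, Finset.mem_filter]
    refine ⟨Nat.find hex, ⟨hspec.1, hspec.2.1⟩, hγ, hspec.2.2, fun i hi hij h => ?_⟩
    exact Nat.find_min hex hij ⟨hi, hij.le.trans hspec.2.1, h⟩
  calc _ ≤ (∑ j ∈ Finset.Icc 1 J, ((matchingInvolutions V).filter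
        (fun γ => ((τ * γ) ^ j) v = v ∧ ∀ i, 0 < i → i < j → ((τ * γ) ^ i) v ≠ v)).card) *
          (Fintype.card V - 2 * J) :=
        Nat.mul_le_mul_right _ ((Finset.card_le_card hsub).trans Finset.card_biUnion_le)
    _ ≤ ∑ j ∈ Finset.Icc 1 J, (matchingInvolutions V).card := by
        rw [Finset.sum_mul]
        refine Finset.sum_le_sum fun j hj => ?_
        rw [Finset.mem_Icc] at hj
        exact (Nat.mul_le_mul_left _ (by omega)).trans (card_minimal_period_mul_le hτ v hj.1)
    _ = _ := by simp

/-- On average over all matching involutions, at most `2 J` vertices lie in orbits of length at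
most `J`. -/
theorem sum_card_shortOrbitVertices_le (hτ : IsMatchingInvolution τ) {J : ℕ}
    (hJ : 4 * J ≤ Fintype.card V) :
    ∑ γ ∈ matchingInvolutions V, (shortOrbitVertices τ γ J).card ≤
      2 * J * (matchingInvolutions V).card := by
  classical
  rcases Nat.eq_zero_or_pos (Fintype.card V) with h0 | hpos
  · have : IsEmpty V := Fintype.card_eq_zero_iff.1 h0
    simp [Finset.eq_empty_of_isEmpty]
  have hsum : ∑ γ ∈ matchingInvolutions V, (shortOrbitVertices τ γ J).card =
      ∑ v : V, ((matchingInvolutions V).filter (fun γ => v ∈ shortOrbitVertices τ γ J)).card := by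
    have := Finset.sum_card_bipartiteAbove_eq_sum_card_bipartiteBelow
      (s := matchingInvolutions V) (t := (Finset.univ : Finset V))
      (fun γ v => v ∈ shortOrbitVertices τ γ J)
    simpa [Finset.bipartiteAbove, Finset.bipartiteBelow] using this
  rw [hsum]
  refine Nat.le_of_mul_le_mul_right ?_ hpos
  calc (∑ v : V, ((matchingInvolutions V).filter
        (fun γ => v ∈ shortOrbitVertices τ γ J)).card) * Fintype.card V
      ≤ (∑ v : V, ((matchingInvolutions V).filter
        (fun γ => v ∈ shortOrbitVertices τ γ J)).card) * (2 * (Fintype.card V - 2 * J)) :=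
        Nat.mul_le_mul_left _ (by omega)
    _ = 2 * ∑ v : V, ((matchingInvolutions V).filter
        (fun γ => v ∈ shortOrbitVertices τ γ J)).card * (Fintype.card V - 2 * J) := by
        rw [Finset.sum_mul, Finset.mul_sum]
        refine Finset.sum_congr rfl fun v _ => by ring
    _ ≤ 2 * ∑ v : V, J * (matchingInvolutions V).card :=
        Nat.mul_le_mul_left _ (Finset.sum_le_sum fun v _ => card_mem_shortOrbitVertices_mul_le hτ v)
    _ = _ := by simp; ring

end Counting

/-! ### Breaks in lists -/

section Breaks

variable {α : Type*}

open Classical in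
/-- The number of pairs of consecutive entries of a list that are not related by `r`. -/
noncomputable def breakCount (r : α → α → Prop) : List α → ℕ
  | [] => 0
  | [_] => 0
  | a :: b :: l => (if r a b then 0 else 1) + breakCount r (b :: l)

@[simp] theorem breakCount_nil (r : α → α → Prop) : breakCount r [] = 0 := rfl

@[simp] theorem breakCount_singleton (r : α → α → Prop) (a : α) : breakCount r [a] = 0 := rfl

open Classical in
theorem breakCount_cons_cons (r : α → α → Prop) (a b : α) (l : List α) :
    breakCount r (a :: b :: l) = (if r a b then 0 else 1) + breakCount r (b :: l) := rfl

theorem breakCount_eq_zero {r : α → α → Prop} : ∀ {l : List α}, l.IsChain r → breakCount r l = 0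
  | [], _ => rfl
  | [_], _ => rfl
  | a :: b :: l, h => by
      rw [List.isChain_cons_cons] at h
      rw [breakCount_cons_cons, if_pos h.1, breakCount_eq_zero h.2]

theorem breakCount_cons_le (r : α → α → Prop) (a : α) (l : List α) :
    breakCount r (a :: l) ≤ 1 + breakCount r l := by
  cases l with
  | nil => simp
  | cons b l => rw [breakCount_cons_cons]; split_ifs <;> omega

theorem breakCount_le_cons (r : α → α → Prop) (a : α) (l : List α) :
    breakCount r l ≤ breakCount r (a :: l) := by
  cases l with
  | nil => simp
  | cons b l => rw [breakCount_cons_cons]; omega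

theorem breakCount_append_le (r : α → α → Prop) : ∀ l₁ l₂ : List α,
    breakCount r (l₁ ++ l₂) ≤ breakCount r l₁ + 1 + breakCount r l₂
  | [], l₂ => by simp
  | [a], l₂ => by simpa using breakCount_cons_le r a l₂
  | a :: b :: l, l₂ => by
      have := breakCount_append_le r (b :: l) l₂
      simp only [List.cons_append, breakCount_cons_cons] at this ⊢
      omega

theorem breakCount_take_le (r : α → α → Prop) : ∀ (l : List α) (k : ℕ),
    breakCount r (l.take k) ≤ breakCount r l
  | [], k => by simp
  | [a], 0 => by simp
  | [a], k + 1 => by simp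
  | a :: b :: l, 0 => by simp
  | a :: b :: l, 1 => by simp
  | a :: b :: l, k + 2 => by
      have := breakCount_take_le r (b :: l) (k + 1)
      simp only [List.take_succ_cons, breakCount_cons_cons] at this ⊢
      omega

open Classical in
/-- Deleting an entry of a list creates at most one new break. -/
theorem breakCount_filter_le (r : α → α → Prop) (p : α → Bool) : ∀ l : List α,
    breakCount r (l.filter p) ≤ breakCount r l + (l.filter (fun a => !p a)).length
  | [] => by simp
  | a :: l => by
      have ih := breakCount_filter_le r p l
      by_cases ha : p a
      · cases l with
        | nil => simp [ha]
        | cons b l =>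
          by_cases hb : p b
          · simp only [List.filter_cons, ha, hb, Bool.not_true, if_true, Bool.false_eq_true,
              if_false] at ih ⊢
            rw [breakCount_cons_cons, breakCount_cons_cons]
            omega
          · have h1 := breakCount_filter_le r p l
            have h2 := breakCount_cons_le r a (l.filter p)
            have h3 := breakCount_le_cons r b l
            have h4 := breakCount_le_cons r a (b :: l)
            simp only [Bool.not_eq_true] at hb
            simp only [List.filter_cons, ha, hb, Bool.not_true, Bool.not_false, if_true,
              Bool.false_eq_true, if_false, List.length_cons] at ih ⊢
            omega
      · rw [List.filter_cons_of_neg ha, List.filter_cons_of_pos (by simpa using ha)]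
        have := breakCount_le_cons r a l
        simp only [List.length_cons]
        omega

open Classical in
theorem breakCount_map_range' (r : α → α → Prop) (w : ℕ → α) : ∀ (k s : ℕ),
    breakCount r ((List.range' s (k + 1)).map w) =
      ((Finset.Ico s (s + k)).filter (fun i => ¬ r (w i) (w (i + 1)))).card
  | 0, s => by simp
  | k + 1, s => by
      have ih := breakCount_map_range' r w k (s + 1)
      rw [List.range'_succ, List.range'_succ, List.map_cons, List.map_cons, breakCount_cons_cons,
        ← List.map_cons, ← List.range'_succ, ih, Finset.card_filter, Finset.card_filter,
        Finset.sum_eq_sum_Ico_succ_bot (by omega : s < s + (k + 1)), add_right_comm s 1 k, ← add_assoc]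
      simp [ite_not]

/-- Every list splits into chains, one more than it has breaks. -/
theorem exists_flatten_isChain (r : α → α → Prop) : ∀ l : List α,
    ∃ P : List (List α), P.flatten = l ∧ (∀ p ∈ P, p ≠ [] ∧ p.IsChain r) ∧
      P.length ≤ breakCount r l + 1
  | [] => ⟨[], by simp⟩
  | [a] => ⟨[[a]], by simp⟩
  | a :: b :: l => by
      obtain ⟨P, hP, hc, hl⟩ := exists_flatten_isChain r (b :: l)
      rw [breakCount_cons_cons]
      by_cases hab : r a b
      · cases P with
        | nil => simp at hP
        | cons p P =>
          obtain ⟨hp, hP'⟩ := List.forall_mem_cons.1 hc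
          obtain ⟨hp0, hp1⟩ := hp
          cases p with
          | nil => exact absurd rfl hp0
          | cons x p =>
            have hx : x = b := by simpa using congrArg List.head? hP
            subst hx
            refine ⟨(a :: x :: p) :: P, by simpa using hP, ?_, by simpa [hab] using hl⟩
            exact List.forall_mem_cons.2 ⟨⟨by simp, List.isChain_cons_cons.2 ⟨hab, hp1⟩⟩, hP'⟩
      · refine ⟨[a] :: P, by simp [hP], ?_, by simp [hab]; omega⟩
        exact List.forall_mem_cons.2 ⟨by simp, hc⟩

end Breaks

/-! ### Ordering the edges of a matching along alternating cycles -/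

section Ordering

variable {V : Type*} {γ τ : Equiv.Perm V}

/-- One orbit of `τ * γ`, listed together with the partners under `γ`, traverses an alternating
cycle without repetition. -/
theorem nodup_flatMap_orbit (hτ : IsMatchingInvolution τ) (hγ : IsMatchingInvolution γ) (a : V)
    {p : ℕ} (hmin : ∀ i, 0 < i → i < p → ((τ * γ) ^ i) a ≠ a) :
    (((List.range p).map fun i => ((τ * γ) ^ i) a).flatMap fun v => [v, γ v]).Nodup := by
  have hinj : ∀ i k, i < k → k < p → ((τ * γ) ^ i) a ≠ ((τ * γ) ^ k) a := by
    intro i k hik hk h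
    apply hmin (k - i) (by omega) (by omega)
    have : k = i + (k - i) := by omega
    rw [this, pow_add, Equiv.Perm.mul_apply, EmbeddingLike.apply_eq_iff_eq] at h
    exact h.symm
  have hτρ : ∀ u, γ u = τ ((τ * γ) u) := fun u => by simp [(hτ _).1]
  have hne : ∀ i k, ((τ * γ) ^ i) a ≠ γ (((τ * γ) ^ k) a) := by
    intro i k h
    rw [hτρ, ← Equiv.Perm.mul_apply (τ * γ), ← pow_succ'] at h
    rcases le_total (k + 1) i with hik | hik
    · obtain ⟨d, rfl⟩ := Nat.exists_eq_add_of_le hik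
      rw [add_comm, pow_add, Equiv.Perm.mul_apply] at h
      exact hτ.pow_mul_apply_ne hγ _ _ h
    · obtain ⟨d, hd⟩ := Nat.exists_eq_add_of_le hik
      rw [hd, add_comm, pow_add, Equiv.Perm.mul_apply] at h
      apply hτ.pow_mul_apply_ne hγ d (((τ * γ) ^ i) a)
      rw [h, (hτ _).1]
      exact congrArg _ h.symm
  rw [List.nodup_flatMap]
  constructor
  · intro x _
    simpa using (hγ x).2.symm
  · rw [List.pairwise_map]
    refine List.pairwise_lt_range.imp_of_mem ?_
    intro i k hi hk hik
    rw [List.mem_range] at hi hk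
    simp only [Function.onFun, List.disjoint_cons_left, List.mem_cons, List.not_mem_nil, or_false,
      not_or, List.disjoint_nil_left, and_true]
    refine ⟨⟨hinj i k hik hk, hne i k⟩, fun h => hne k i h.symm, fun h => ?_⟩
    exact hinj i k hik hk (γ.injective h)

variable [Fintype V]

theorem exists_pow_apply_eq_self (σ : Equiv.Perm V) (a : V) : ∃ j, 0 < j ∧ (σ ^ j) a = a :=
  ⟨orderOf σ, orderOf_pos σ, by simp [pow_orderOf_eq_one]⟩

open Classical in
/-- The ordering of `exists_ordering`, restricted to a union `U` of alternating cycles. Each cycle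
costs one break; it is paid for either by its more than `J` vertices, or by a vertex in a short
orbit. -/
theorem exists_ordering_of_closed (hτ : IsMatchingInvolution τ) (hγ : IsMatchingInvolution γ)
    (J : ℕ) : ∀ (N : ℕ) (U : Finset V), U.card = N → (∀ v ∈ U, τ v ∈ U) → (∀ v ∈ U, γ v ∈ U) →
    ∃ A : List V, (A.flatMap fun v => [v, γ v]).Nodup ∧
      (∀ v, v ∈ A.flatMap (fun v => [v, γ v]) ↔ v ∈ U) ∧
      (A = [] ∨ J * (breakCount (fun u v => v = τ (γ u)) A + 1) ≤
        U.card + J * (U ∩ shortOrbitVertices τ γ J).card) := by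
  intro N
  induction N using Nat.strong_induction_on with
  | _ N ih =>
  intro U hN hUτ hUγ
  rcases U.eq_empty_or_nonempty with rfl | ⟨a, ha⟩
  · exact ⟨[], by simp⟩
  have hex := exists_pow_apply_eq_self (τ * γ) a
  set p := Nat.find hex with hp
  obtain ⟨hp0, hper⟩ := Nat.find_spec hex
  rw [← hp] at hp0 hper
  have hmin : ∀ i, 0 < i → i < p → ((τ * γ) ^ i) a ≠ a :=
    fun i hi hip h => Nat.find_min hex hip ⟨hi, h⟩
  set P : List V := (List.range p).map fun i => ((τ * γ) ^ i) a with hP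
  have hnd := nodup_flatMap_orbit hτ hγ a hmin
  rw [← hP] at hnd
  set O : Finset V := (P.flatMap fun v => [v, γ v]).toFinset with hO
  have hmemO : ∀ v, v ∈ O ↔ ∃ i < p, v = ((τ * γ) ^ i) a ∨ v = γ (((τ * γ) ^ i) a) := by
    intro v
    simp [hO, hP]
  have hOcard : O.card = 2 * p := by
    rw [hO, List.toFinset_card_of_nodup hnd, List.length_flatMap]
    simp [hP, Function.comp_def, mul_comm]
  have hOU : O ⊆ U := by
    intro v hv
    obtain ⟨i, -, hi⟩ := (hmemO v).1 hv
    have : ((τ * γ) ^ i) a ∈ U := by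
      clear hi
      induction i with
      | zero => simpa using ha
      | succ i ih =>
        rw [pow_succ', Equiv.Perm.mul_apply]
        exact hUτ _ (hUγ _ ih)
    rcases hi with rfl | rfl
    · exact this
    · exact hUγ _ this
  have hOγ : ∀ v, γ v ∈ O → v ∈ O := by
    intro v hv
    obtain ⟨i, hip, hi | hi⟩ := (hmemO _).1 hv
    · exact (hmemO v).2 ⟨i, hip, Or.inr (by rw [← hi, (hγ v).1])⟩
    · exact (hmemO v).2 ⟨i, hip, Or.inl (γ.injective hi)⟩
  have hOτ : ∀ v, τ v ∈ O → v ∈ O := by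
    intro v hv
    have hτγ : ∀ u, τ ((τ * γ) u) = γ u := fun u => by simp [(hτ _).1]
    obtain ⟨i, hip, hi | hi⟩ := (hmemO _).1 hv
    · have hv' : v = τ (((τ * γ) ^ i) a) := by rw [← hi, (hτ v).1]
      rcases Nat.eq_zero_or_pos i with rfl | hi0
      · refine (hmemO v).2 ⟨p - 1, by omega, Or.inr ?_⟩
        rw [hv', pow_zero, Equiv.Perm.one_apply, ← hτγ, ← Equiv.Perm.mul_apply (τ * γ), ← pow_succ',
          Nat.sub_add_cancel hp0, hper]
      · refine (hmemO v).2 ⟨i - 1, by omega, Or.inr ?_⟩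
        rw [hv', ← hτγ, ← Equiv.Perm.mul_apply (τ * γ), ← pow_succ', Nat.sub_add_cancel hi0]
    · have hv' : v = ((τ * γ) ^ (i + 1)) a := by
        rw [pow_succ', Equiv.Perm.mul_apply, Equiv.Perm.mul_apply, ← hi, (hτ v).1]
      rcases Nat.lt_or_ge (i + 1) p with h | h
      · exact (hmemO v).2 ⟨i + 1, h, Or.inl hv'⟩
      · refine (hmemO v).2 ⟨0, hp0, Or.inl ?_⟩
        rw [hv', show i + 1 = p by omega, hper]
        simp
  have hcardU : (U \ O).card + 2 * p = U.card := by
    rw [← hOcard]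
    exact Finset.card_sdiff_add_card_eq_card hOU
  obtain ⟨A, hA1, hA2, hA3⟩ := ih (U \ O).card (by omega) (U \ O) rfl
    (fun v hv => by
      rw [Finset.mem_sdiff] at hv ⊢
      exact ⟨hUτ v hv.1, fun h => hv.2 (hOτ v h)⟩)
    (fun v hv => by
      rw [Finset.mem_sdiff] at hv ⊢
      exact ⟨hUγ v hv.1, fun h => hv.2 (hOγ v h)⟩)
  have hPchain : breakCount (fun u v => v = τ (γ u)) P = 0 := by
    refine breakCount_eq_zero ?_
    rw [hP, List.isChain_map, List.isChain_iff_getElem]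
    intro i hi
    simp [pow_succ']
  have hshort : J ≤ 2 * p + J * (O ∩ shortOrbitVertices τ γ J).card := by
    rcases Nat.lt_or_ge J p with h | h
    · omega
    · have : a ∈ O ∩ shortOrbitVertices τ γ J :=
        Finset.mem_inter.2 ⟨(hmemO a).2 ⟨0, hp0, Or.inl (by simp)⟩,
          mem_shortOrbitVertices.2 ⟨p, hp0, h, hper⟩⟩
      have h1 : 1 ≤ (O ∩ shortOrbitVertices τ γ J).card := Finset.card_pos.2 ⟨a, this⟩
      nlinarith
  have hsplit : (U ∩ shortOrbitVertices τ γ J).card =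
      ((U \ O) ∩ shortOrbitVertices τ γ J).card + (O ∩ shortOrbitVertices τ γ J).card := by
    rw [← Finset.card_union_of_disjoint, ← Finset.union_inter_distrib_right,
      Finset.sdiff_union_of_subset hOU]
    exact Finset.disjoint_of_subset_left Finset.inter_subset_left
      (Finset.disjoint_of_subset_right Finset.inter_subset_left Finset.sdiff_disjoint)
  refine ⟨P ++ A, ?_, ?_, Or.inr ?_⟩
  · rw [List.flatMap_append, List.nodup_append]
    refine ⟨hnd, hA1, fun x hx y hy hxy => ?_⟩
    subst hxy
    have := (Finset.mem_sdiff.1 ((hA2 x).1 hy)).2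
    exact this (List.mem_toFinset.2 hx)
  · intro v
    rw [List.flatMap_append, List.mem_append, hA2, Finset.mem_sdiff, ← List.mem_toFinset, ← hO]
    by_cases hv : v ∈ O
    · simp [hv, hOU hv]
    · simp [hv]
  · rcases hA3 with rfl | hA3
    · rw [List.append_nil, hPchain, hsplit]
      simp only [mul_add]
      omega
    · have hb := breakCount_append_le (fun u v => v = τ (γ u)) P A
      rw [hPchain] at hb
      have := Nat.mul_le_mul_left J (Nat.add_le_add_right hb 1)
      rw [hsplit]
      simp only [mul_add] at *
      omega

/-- The edges of `γ` can be ordered and oriented so that the partner of the end of each edge under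
`τ` is the start of the next one, with few exceptions: one per alternating cycle, and there are at
most `n / J` cycles with orbits longer than `J`. -/
theorem exists_ordering (hτ : IsMatchingInvolution τ) (hγ : IsMatchingInvolution γ) (J : ℕ) :
    ∃ A : List V, (A.flatMap fun v => [v, γ v]).Nodup ∧
      (∀ v, v ∈ A.flatMap (fun v => [v, γ v])) ∧
      J * breakCount (fun u v => v = τ (γ u)) A ≤
        Fintype.card V + J * (shortOrbitVertices τ γ J).card := by
  classical
  obtain ⟨A, h1, h2, h3⟩ := exists_ordering_of_closed hτ hγ J _ Finset.univ rfl (by simp) (by simp)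
  refine ⟨A, h1, fun v => (h2 v).2 (Finset.mem_univ v), ?_⟩
  rcases h3 with rfl | h3
  · simp
  · rw [Finset.univ_inter, Finset.card_univ] at h3
    nlinarith

end Ordering

/-! ### Cyclic lists with insertions -/

section CyclicLists

/-- Finitely many requests with at least as many options each as there are requests can be granted
with distinct options. -/
theorem exists_injOn_choice (Q : Finset ℕ) (O : ℕ → Finset ℕ) (h : ∀ q ∈ Q, Q.card ≤ (O q).card) :
    ∃ κ : ℕ → ℕ, Set.InjOn κ Q ∧ ∀ q ∈ Q, κ q ∈ O q := by
  classical
  induction Q using Finset.induction_on with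
  | empty => exact ⟨id, by simp⟩
  | insert a Q ha ih =>
    obtain ⟨κ, h1, h2⟩ := ih fun q hq =>
      (Finset.card_le_card (Finset.subset_insert a Q)).trans (h q (Finset.mem_insert_of_mem hq))
    have hlt : (Q.image κ).card < (O a).card := by
      have := h a (Finset.mem_insert_self a Q)
      rw [Finset.card_insert_of_notMem ha] at this
      exact lt_of_le_of_lt Finset.card_image_le this
    obtain ⟨b, hb, hb'⟩ := Finset.exists_mem_notMem_of_card_lt_card hlt
    have hne : ∀ q ∈ Q, q ≠ a := fun q hq h => ha (h ▸ hq)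
    refine ⟨Function.update κ a b, ?_, ?_⟩
    · intro x hx y hy hxy
      rw [Finset.mem_coe, Finset.mem_insert] at hx hy
      rcases hx with rfl | hx <;> rcases hy with rfl | hy
      · rfl
      · rw [Function.update_self, Function.update_of_ne (hne y hy)] at hxy
        exact absurd (Finset.mem_image.2 ⟨y, hy, hxy.symm⟩) hb'
      · rw [Function.update_self, Function.update_of_ne (hne x hx)] at hxy
        exact absurd (Finset.mem_image.2 ⟨x, hx, hxy⟩) hb'
      · rw [Function.update_of_ne (hne x hx), Function.update_of_ne (hne y hy)] at hxy
        exact h1 hx hy hxy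
    · intro q hq
      rw [Finset.mem_insert] at hq
      rcases hq with rfl | hq
      · rwa [Function.update_self]
      · rw [Function.update_of_ne (hne q hq)]
        exact h2 q hq

/-- Disjoint pieces `p ∈ P`, each with at least as many admissible slots `O p` as there are pieces,
can be put into distinct slots; `f i` is the piece in slot `i`, or `[]`. -/
theorem exists_placement {α : Type*} (F : Finset ℕ) (O : List α → Finset ℕ) :
    ∀ P : List (List α), (∀ p ∈ P, O p ⊆ F ∧ P.length ≤ (O p).card) → P.flatten.Nodup →
    ∃ (f : ℕ → List α) (U : Finset ℕ), U.card ≤ P.length ∧ (∀ i, f i ≠ [] → i ∈ U) ∧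
      (∀ i, f i ≠ [] → f i ∈ P ∧ i ∈ O (f i)) ∧ (∀ i j, i ≠ j → (f i).Disjoint (f j)) ∧
      (∀ i, ∀ x ∈ f i, x ∈ P.flatten) ∧ ∑ i ∈ F, (f i).length = P.flatten.length
  | [], _, _ => ⟨fun _ => [], ∅, by simp⟩
  | p :: P, hO, hnd => by
      rw [List.flatten_cons, List.nodup_append'] at hnd
      obtain ⟨f, U, hU, hfU, hf1, hf2, hf3, hf4⟩ := exists_placement F O P
        (fun q hq => ⟨(hO q (List.mem_cons_of_mem _ hq)).1,
          (Nat.le_succ _).trans (hO q (List.mem_cons_of_mem _ hq)).2⟩) hnd.2.1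
      obtain ⟨hpF, hpO⟩ := hO p List.mem_cons_self
      obtain ⟨b, hb, hb'⟩ := Finset.exists_mem_notMem_of_card_lt_card
        (lt_of_le_of_lt hU (Nat.lt_of_succ_le hpO))
      have hfb : f b = [] := by
        by_contra h
        exact hb' (hfU b h)
      have hdis : ∀ i, p.Disjoint (f i) := fun i x hx hx' => hnd.2.2 hx (hf3 i x hx')
      refine ⟨Function.update f b p, insert b U, ?_, ?_, ?_, ?_, ?_, ?_⟩
      · rw [Finset.card_insert_of_notMem hb', List.length_cons]; omega
      · intro i hi
        rcases eq_or_ne i b with rfl | hib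
        · exact Finset.mem_insert_self _ _
        · rw [Function.update_of_ne hib] at hi
          exact Finset.mem_insert_of_mem (hfU i hi)
      · intro i hi
        rcases eq_or_ne i b with rfl | hib
        · rw [Function.update_self]
          exact ⟨List.mem_cons_self, hb⟩
        · rw [Function.update_of_ne hib] at hi ⊢
          exact ⟨List.mem_cons_of_mem _ (hf1 i hi).1, (hf1 i hi).2⟩
      · intro i j hij
        rcases eq_or_ne i b with rfl | hib
        · rw [Function.update_self, Function.update_of_ne hij.symm]
          exact hdis j
        · rcases eq_or_ne j b with rfl | hjb
          · rw [Function.update_self, Function.update_of_ne hib]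
            exact (hdis i).symm
          · rw [Function.update_of_ne hib, Function.update_of_ne hjb]
            exact hf2 i j hij
      · intro i x hx
        rw [List.flatten_cons, List.mem_append]
        rcases eq_or_ne i b with rfl | hib
        · rw [Function.update_self] at hx
          exact Or.inl hx
        · rw [Function.update_of_ne hib] at hx
          exact Or.inr (hf3 i x hx)
      · have hbF := hpF hb
        rw [List.flatten_cons, List.length_append, ← hf4, ← Finset.add_sum_erase F _ hbF,
          ← Finset.add_sum_erase F (fun i => (f i).length) hbF]
        simp only [Function.update_self, hfb, List.length_nil, zero_add]
        congr 1
        refine Finset.sum_congr rfl fun i hi => ?_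
        rw [Function.update_of_ne (Finset.ne_of_mem_erase hi)]

variable {r : ℕ → ℕ → Prop}

theorem isChain_flatMap_range' (I : ℕ → List ℕ) (x : ℕ) : ∀ (k s : ℕ),
    (∀ l, s ≤ l → l < s + k → (l :: I l ++ [l + 1]).IsChain r) →
    ((s + k) :: I (s + k) ++ [x]).IsChain r →
    ((List.range' s (k + 1)).flatMap (fun l => l :: I l) ++ [x]).IsChain r
  | 0, s, _, h2 => by simpa using h2
  | k + 1, s, h1, h2 => by
      have ih := isChain_flatMap_range' I x k (s + 1) (fun l hl hl' => h1 l (by omega) (by omega))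
        (by rwa [add_right_comm, add_assoc])
      have h0 := h1 s le_rfl (by omega)
      rw [List.range'_succ, List.flatMap_cons]
      rw [List.range'_succ, List.flatMap_cons] at ih ⊢
      have := List.IsChain.append_overlap (l₁ := s :: I s) (l₂ := [s + 1])
        (l₃ := I (s + 1) ++ ((List.range' (s + 1 + 1) k).flatMap (fun l => l :: I l)) ++ [x])
        h0 (by simpa using ih) (by simp)
      simpa using this

/-- `HasCyclicList r n N` says that there is a cyclic sequence of `N` different numbers below `n`,
written `s :: L`, in which cyclically consecutive entries are related by `r`. -/
def HasCyclicList (r : ℕ → ℕ → Prop) (n N : ℕ) : Prop :=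
  ∃ (s : ℕ) (L : List ℕ), (s :: L).Nodup ∧ (∀ x ∈ s :: L, x < n) ∧ (s :: L ++ [s]).IsChain r ∧
    (s :: L).length = N

/-- An interval of numbers, with a list `I l` of numbers below the interval inserted after each of
its elements `l`, is a cyclic list. -/
theorem hasCyclicList_of_blocks {n s k : ℕ} (I : ℕ → List ℕ) (hn : s + k + 1 ≤ n)
    (h1 : ∀ l, s ≤ l → l < s + k → (l :: I l ++ [l + 1]).IsChain r)
    (h2 : ((s + k) :: I (s + k) ++ [s]).IsChain r) (hlt : ∀ l, ∀ x ∈ I l, x < s)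
    (hnd : ∀ l, (I l).Nodup) (hdis : ∀ l l', l ≠ l' → (I l).Disjoint (I l')) :
    HasCyclicList r n (k + 1 + ∑ l ∈ Finset.Ico s (s + k + 1), (I l).length) := by
  have hL : (List.range' s (k + 1)).flatMap (fun l => l :: I l) =
      s :: (I s ++ (List.range' (s + 1) k).flatMap (fun l => l :: I l)) := by
    rw [List.range'_succ, List.flatMap_cons, List.cons_append]
  refine ⟨s, I s ++ (List.range' (s + 1) k).flatMap (fun l => l :: I l), ?_, ?_, ?_, ?_⟩
  · rw [← hL, List.nodup_flatMap]
    constructor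
    · intro l hl
      rw [List.mem_range'_1] at hl
      exact List.nodup_cons.2 ⟨fun h => by have := hlt l l h; omega, hnd l⟩
    · refine (List.pairwise_lt_range' ..).imp_of_mem ?_
      intro l l' hl hl' hll
      rw [List.mem_range'_1] at hl hl'
      intro x hx hx'
      rw [List.mem_cons] at hx hx'
      rcases hx with rfl | hx <;> rcases hx' with rfl | hx'
      · omega
      · have := hlt _ _ hx'; omega
      · have := hlt _ _ hx; omega
      · exact hdis l l' hll.ne hx hx'
  · intro x hx
    rw [← hL, List.mem_flatMap] at hx
    obtain ⟨l, hl, hx⟩ := hx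
    rw [List.mem_range'_1] at hl
    rw [List.mem_cons] at hx
    rcases hx with rfl | hx
    · omega
    · have := hlt _ _ hx; omega
  · rw [← hL]
    exact isChain_flatMap_range' I s k s h1 h2
  · rw [← hL, List.length_flatMap]
    simp only [List.length_cons]
    rw [show s + k + 1 = s + (k + 1) by ring]
    generalize k + 1 = K
    clear hL hn h1 h2 hlt
    induction K generalizing s with
    | zero => simp
    | succ K ih =>
      rw [List.range'_succ, List.map_cons, List.sum_cons, ih,
        Finset.sum_eq_sum_Ico_succ_bot (by omega : s < s + (K + 1)),
        show s + (K + 1) = s + 1 + K by ring]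
      ring

/-- The interval `[s, 2 j)` with two kinds of insertions: a connector `2 κ l, 2 κ l + 1` after
each `l ∈ Q`, which includes the end of the interval, and pieces `f i` between `2 i` and `2 i + 1`
for `i ∈ F`. -/
theorem hasCyclicList_of_connectors {m c s j : ℕ} (hcs : 2 * c ≤ s) (hsj : s < 2 * j) (hjm : j ≤ m)
    (hedge : ∀ i < m, r (2 * i) (2 * i + 1)) (Q : Finset ℕ) (hQodd : ∀ l ∈ Q, Odd l)
    (hQsub : Q ⊆ Finset.Ico s (2 * j)) (hQlast : 2 * j - 1 ∈ Q)
    (hQ : ∀ i, s ≤ 2 * i + 1 → i + 1 < j → 2 * i + 1 ∉ Q → r (2 * i + 1) (2 * i + 2))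
    (κ : ℕ → ℕ) (hκ : Set.InjOn κ Q) (hκc : ∀ l ∈ Q, κ l < c)
    (hκr : ∀ l ∈ Q, r l (2 * κ l) ∧ r (2 * κ l + 1) (if l = 2 * j - 1 then s else l + 1))
    (F : Finset ℕ) (hF : ∀ i ∈ F, s ≤ 2 * i ∧ i < j) (f : ℕ → List ℕ)
    (hfF : ∀ i, f i ≠ [] → i ∈ F ∧ (2 * i :: f i ++ [2 * i + 1]).IsChain r)
    (hf : ∀ i, ∀ x ∈ f i, x < 2 * c ∧ ∀ l ∈ Q, x ≠ 2 * κ l ∧ x ≠ 2 * κ l + 1)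
    (hfnd : ∀ i, (f i).Nodup) (hfdis : ∀ i i', i ≠ i' → (f i).Disjoint (f i')) :
    HasCyclicList r (2 * m) (2 * j - s + 2 * Q.card + ∑ i ∈ F, (f i).length) := by
  classical
  let C : ℕ → List ℕ := fun l => if l ∈ Q then [2 * κ l, 2 * κ l + 1] else []
  let E : ℕ → List ℕ := fun l => if Even l then f (l / 2) else []
  have hCE : ∀ l, C l ≠ [] → E l = [] := by
    intro l hl
    by_cases h : l ∈ Q
    · simp [E, Nat.not_even_iff_odd.2 (hQodd l h)]
    · simp [C, h] at hl
  have hmemC : ∀ l, ∀ x ∈ C l, l ∈ Q ∧ (x = 2 * κ l ∨ x = 2 * κ l + 1) := by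
    intro l x hx
    by_cases h : l ∈ Q
    · simpa [C, h] using hx
    · simp [C, h] at hx
  have hmemE : ∀ l, ∀ x ∈ E l, Even l ∧ x ∈ f (l / 2) := by
    intro l x hx
    by_cases h : Even l
    · simpa [E, h] using hx
    · simp [E, h] at hx
  have key := hasCyclicList_of_blocks (r := r) (n := 2 * m) (s := s) (k := 2 * j - s - 1)
    (fun l => C l ++ E l) (by omega) ?_ ?_ ?_ ?_ ?_
  · convert key using 1
    have hsum : ∑ l ∈ Finset.Ico s (s + (2 * j - s - 1) + 1), (C l ++ E l).length =
        2 * Q.card + ∑ i ∈ F, (f i).length := by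
      rw [show s + (2 * j - s - 1) + 1 = 2 * j by omega]
      simp only [List.length_append]
      rw [Finset.sum_add_distrib]
      congr 1
      · rw [← Finset.sum_subset hQsub]
        · rw [mul_comm, ← smul_eq_mul, ← Finset.sum_const]
          exact Finset.sum_congr rfl fun l hl => by simp [C, hl]
        · intro l _ hl
          simp [C, hl]
      · have hinj : Function.Injective (fun i : ℕ => 2 * i) := fun a b h => by simpa using h
        rw [← Finset.sum_subset (s₁ := F.image fun i => 2 * i)]
        · rw [Finset.sum_image hinj.injOn]
          exact Finset.sum_congr rfl fun i _ => by simp [E]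
        · intro l hl
          obtain ⟨i, hi, rfl⟩ := Finset.mem_image.1 hl
          have := hF i hi
          rw [Finset.mem_Ico]
          omega
        · intro l _ hl
          by_contra h
          have hE : E l ≠ [] := fun h' => h (by simp [h'])
          obtain ⟨x, hx⟩ := List.exists_mem_of_ne_nil _ hE
          obtain ⟨hl', hx'⟩ := hmemE l x hx
          refine hl (Finset.mem_image.2 ⟨l / 2, (hfF _ (List.ne_nil_of_mem hx')).1, ?_⟩)
          exact Nat.two_mul_div_two_of_even hl'
    rw [hsum]
    omega
  · intro l hl hl'
    rcases Nat.even_or_odd' l with ⟨i, rfl | rfl⟩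
    · have hC : C (2 * i) = [] := by
        by_contra h
        obtain ⟨x, hx⟩ := List.exists_mem_of_ne_nil _ h
        have := hQodd _ (hmemC _ x hx).1
        exact Nat.not_even_iff_odd.2 this (even_two_mul i)
      have hE : E (2 * i) = f i := by simp [E]
      simp only [hC, hE, List.nil_append]
      by_cases hfi : f i = []
      · simpa [hfi] using hedge i (by omega)
      · exact (hfF i hfi).2
    · have hE : E (2 * i + 1) = [] := by simp [E]
      simp only [hE, List.append_nil]
      by_cases hi : 2 * i + 1 ∈ Q
      · have := hκr _ hi
        rw [if_neg (by omega)] at this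
        simp only [C, hi, if_true]
        simpa using ⟨this.1, hedge _ ((hκc _ hi).trans (by omega)), this.2⟩
      · simpa [C, hi] using hQ i hl (by omega) hi
  · rw [show s + (2 * j - s - 1) = 2 * j - 1 by omega]
    have := hκr _ hQlast
    rw [if_pos rfl] at this
    have hE : E (2 * j - 1) = [] := hCE _ (by simp [C, hQlast])
    simp only [hE, C, hQlast, if_true]
    simpa using ⟨this.1, hedge _ ((hκc _ hQlast).trans (by omega)), this.2⟩
  · intro l x hx
    rw [List.mem_append] at hx
    rcases hx with hx | hx
    · obtain ⟨hl, hx⟩ := hmemC l x hx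
      have := hκc l hl
      omega
    · exact (hf _ x (hmemE l x hx).2).1.trans_le hcs
  · intro l
    by_cases hC : C l = []
    · simp only [hC, List.nil_append]
      by_cases h : Even l
      · simpa [E, h] using hfnd _
      · simp [E, h]
    · simp only [hCE l hC, List.append_nil]
      by_cases h : l ∈ Q
      · simp [C, h]
      · simp [C, h]
  · intro l l' hll x hx hx'
    rw [List.mem_append] at hx hx'
    rcases hx with hx | hx <;> rcases hx' with hx' | hx'
    · obtain ⟨hl, hx⟩ := hmemC l x hx
      obtain ⟨hl', hx'⟩ := hmemC l' x hx'
      exact hll (hκ hl hl' (by omega))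
    · obtain ⟨hl, hx⟩ := hmemC l x hx
      have := (hf _ x (hmemE l' x hx').2).2 l hl
      omega
    · obtain ⟨hl, hx'⟩ := hmemC l' x hx'
      have := (hf _ x (hmemE l x hx).2).2 l' hl
      omega
    · obtain ⟨hl, hx⟩ := hmemE l x hx
      obtain ⟨hl', hx'⟩ := hmemE l' x hx'
      refine hfdis (l / 2) (l' / 2) (fun h => hll ?_) hx hx'
      rw [← Nat.two_mul_div_two_of_even hl, h, Nat.two_mul_div_two_of_even hl']

end CyclicLists

/-! ### Cycles of all lengths from an ordering -/

section Lengths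

variable {r : ℕ → ℕ → Prop}

open Classical in
/-- The bad links of an ordering in a window: the edges `i` in the window such that the end of edge
`i` is not related to the start of edge `i + 1`. -/
noncomputable def badLinks (r : ℕ → ℕ → Prop) (a b : ℕ) : Finset ℕ :=
  (Finset.Ico a b).filter fun i => ¬ r (2 * i + 1) (2 * i + 2)

theorem mem_badLinks {a b i : ℕ} :
    i ∈ badLinks r a b ↔ (a ≤ i ∧ i < b) ∧ ¬ r (2 * i + 1) (2 * i + 2) := by
  simp [badLinks]

theorem badLinks_mono {a b a' b' : ℕ} (ha : a' ≤ a) (hb : b ≤ b') :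
    badLinks r a b ⊆ badLinks r a' b' := by
  intro i
  simp only [mem_badLinks]
  rintro ⟨h1, h2⟩
  exact ⟨by omega, h2⟩

theorem card_badLinks_succ_le (a b : ℕ) :
    (badLinks r a (b + 1)).card ≤ (badLinks r a b).card + 1 := by
  classical
  refine (Finset.card_le_card (t := insert b (badLinks r a b)) ?_).trans (Finset.card_insert_le _ _)
  intro i
  simp only [Finset.mem_insert, mem_badLinks]
  rintro ⟨h1, h2⟩
  by_cases hib : i = b
  · exact Or.inl hib
  · exact Or.inr ⟨by omega, h2⟩

open Classical in
/-- Breaks in the vertex sequence occur only at bad links. -/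
theorem breakCount_range_two_mul_le {m c : ℕ} (hcm : c + 1 < m)
    (hedge : ∀ i < m, r (2 * i) (2 * i + 1)) :
    breakCount r (List.range (2 * c)) ≤ (badLinks r 0 (m - 1)).card := by
  rcases Nat.eq_zero_or_pos c with rfl | hc
  · simp
  have h := breakCount_map_range' r id (2 * c - 1) 0
  rw [Nat.sub_add_cancel (by omega), ← List.range_eq_range', List.map_id] at h
  rw [h]
  refine Finset.card_le_card_of_injOn (fun l => l / 2) ?_ ?_
  · intro l hl
    simp only [id_eq, Finset.coe_filter, Finset.mem_Ico, Set.mem_ofPred_eq, zero_add] at hl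
    rw [Finset.mem_coe, mem_badLinks]
    rcases Nat.even_or_odd' l with ⟨i, rfl | rfl⟩
    · exact absurd (hedge i (by omega)) hl.2
    · simp only [show (2 * i + 1) / 2 = i by omega]
      exact ⟨by omega, hl.2⟩
  · intro l hl l' hl' hll
    simp only [id_eq, Finset.coe_filter, Finset.mem_Ico, Set.mem_ofPred_eq, zero_add] at hl hl'
    have hodd : ∀ l, l < 2 * c - 1 → ¬ r l (l + 1) → l % 2 = 1 := by
      intro l hl hr
      by_contra h
      apply hr
      have := hedge (l / 2) (by omega)
      rwa [show 2 * (l / 2) = l by omega] at this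
    have h1 := hodd l (by omega) hl.2
    have h2 := hodd l' (by omega) hl'.2
    simp only at hll
    omega

/-- The places after which the window of edges `[c, j)` needs a connector: its bad links, and its
end. -/
noncomputable def connectorPlaces (r : ℕ → ℕ → Prop) (c j : ℕ) : Finset ℕ :=
  insert (2 * j - 1) ((badLinks r (c + 1) (j - 1)).image fun i => 2 * i + 1)

theorem mem_connectorPlaces {c j l : ℕ} : l ∈ connectorPlaces r c j ↔
    l = 2 * j - 1 ∨ ∃ i, i ∈ badLinks r (c + 1) (j - 1) ∧ 2 * i + 1 = l := by
  simp [connectorPlaces]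

theorem card_connectorPlaces {c j : ℕ} (hj : 0 < j) :
    (connectorPlaces r c j).card = (badLinks r (c + 1) (j - 1)).card + 1 := by
  rw [connectorPlaces, Finset.card_insert_of_notMem, Finset.card_image_of_injective]
  · intro a b h
    simpa using h
  · intro h
    obtain ⟨i, hi, h⟩ := Finset.mem_image.1 h
    have := (mem_badLinks.1 hi).1
    omega

variable {m R c₁ c c₂ : ℕ}

open Classical in
/-- Distinct edges from `[0, c₁)` can be assigned to the places of the window `[s, 2 j)` that need a
connector. The connector after the end of the window leads back to its start `s`. -/
theorem exists_connectors (hbad : (badLinks r 0 (m - 1)).card ≤ R)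
    (hE : ∀ x < 2 * m, ∀ y < 2 * m, 3 * R + 3 ≤
      ((Finset.range c₁).filter fun i => r x (2 * i) ∧ r (2 * i + 1) y).card)
    {s j : ℕ} (hcj : c < j) (hjm : j ≤ m) (hsj : s < 2 * j) :
    ∃ κ : ℕ → ℕ, Set.InjOn κ (connectorPlaces r c j) ∧ ∀ l ∈ connectorPlaces r c j,
      κ l < c₁ ∧ r l (2 * κ l) ∧ r (2 * κ l + 1) (if l = 2 * j - 1 then s else l + 1) := by
  have hO : ∀ l ∈ connectorPlaces r c j, (connectorPlaces r c j).card ≤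
      ((Finset.range c₁).filter fun i => r l (2 * i) ∧
        r (2 * i + 1) (if l = 2 * j - 1 then s else l + 1)).card := by
    intro l hl
    have hcard := Finset.card_le_card (badLinks_mono (r := r) (a := c + 1) (b := j - 1) (a' := 0)
      (b' := m - 1) (by omega) (by omega))
    rw [card_connectorPlaces (by omega)]
    refine le_trans (by omega) (hE l ?_ _ ?_)
    · rcases mem_connectorPlaces.1 hl with rfl | ⟨i, hi, rfl⟩
      · omega
      · have := (mem_badLinks.1 hi).1
        omega
    · split_ifs with h
      · omega
      · rcases mem_connectorPlaces.1 hl with rfl | ⟨i, hi, rfl⟩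
        · omega
        · have := (mem_badLinks.1 hi).1
          omega
  obtain ⟨κ, h1, h2⟩ := exists_injOn_choice _ _ hO
  exact ⟨κ, h1, fun l hl => by simpa using h2 l hl⟩

/-- Dropping up to three vertices at the start of the window does not affect the connectors, since
the first link is good. -/
theorem connectorPlaces_spec {s j : ℕ} (hcs : 2 * c ≤ s) (hs : s ≤ 2 * c + 3) (hsj : s < 2 * j)
    (hgood : r (2 * c + 1) (2 * c + 2)) :
    (∀ l ∈ connectorPlaces r c j, Odd l) ∧ connectorPlaces r c j ⊆ Finset.Ico s (2 * j) ∧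
      2 * j - 1 ∈ connectorPlaces r c j ∧ ∀ i, s ≤ 2 * i + 1 → i + 1 < j →
        2 * i + 1 ∉ connectorPlaces r c j → r (2 * i + 1) (2 * i + 2) := by
  refine ⟨?_, ?_, mem_connectorPlaces.2 (Or.inl rfl), ?_⟩
  · intro l hl
    rcases mem_connectorPlaces.1 hl with rfl | ⟨i, hi, rfl⟩
    · exact ⟨j - 1, by omega⟩
    · exact ⟨i, rfl⟩
  · intro l hl
    rw [Finset.mem_Ico]
    rcases mem_connectorPlaces.1 hl with rfl | ⟨i, hi, rfl⟩
    · omega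
    · have := (mem_badLinks.1 hi).1
      omega
  · intro i hi hij hn
    by_contra hr
    rcases (show c ≤ i by omega).eq_or_lt with rfl | hci
    · exact hr hgood
    · exact hn (mem_connectorPlaces.2 (Or.inr ⟨i, mem_badLinks.2 ⟨by omega, hr⟩, rfl⟩))

open Classical in
/-- The window `[s, 2 j)`, closed up to a cycle with connectors. -/
theorem hasCyclicList_window (hedge : ∀ i < m, r (2 * i) (2 * i + 1))
    (hbad : (badLinks r 0 (m - 1)).card ≤ R) (hc₁ : c₁ ≤ c)
    (hgood : r (2 * c + 1) (2 * c + 2))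
    (hE : ∀ x < 2 * m, ∀ y < 2 * m, 3 * R + 3 ≤
      ((Finset.range c₁).filter fun i => r x (2 * i) ∧ r (2 * i + 1) y).card)
    {s j : ℕ} (hcs : 2 * c ≤ s) (hs : s ≤ 2 * c + 3) (hsj : s < 2 * j) (hjm : j ≤ m) :
    HasCyclicList r (2 * m) (2 * j - s + 2 * ((badLinks r (c + 1) (j - 1)).card + 1)) := by
  obtain ⟨κ, hκ, hκ'⟩ := exists_connectors (c := c) hbad hE (by omega) hjm hsj
  obtain ⟨h1, h2, h3, h4⟩ := connectorPlaces_spec (r := r) hcs hs hsj hgood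
  have := hasCyclicList_of_connectors hcs hsj hjm hedge _ h1 h2 h3 h4 κ hκ
    (fun l hl => (hκ' l hl).1.trans_le hc₁) (fun l hl => (hκ' l hl).2) ∅ (by simp) (fun _ => [])
    (by simp) (by simp) (by simp) (by simp)
  rw [card_connectorPlaces (by omega)] at this
  simpa using this

open Classical in
/-- The full window `[2 c, 2 m)`, closed up to a cycle with connectors, into which any number of the
remaining vertices is absorbed through the edges in `[c₂, m)`. -/
theorem hasCyclicList_absorb (hedge : ∀ i < m, r (2 * i) (2 * i + 1))
    (hbad : (badLinks r 0 (m - 1)).card ≤ R) (hc₁ : c₁ ≤ c) (hc₂ : c < c₂) (hc₂m : c₂ < m)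
    (hgood : r (2 * c + 1) (2 * c + 2))
    (hE : ∀ x < 2 * m, ∀ y < 2 * m, 3 * R + 3 ≤
      ((Finset.range c₁).filter fun i => r x (2 * i) ∧ r (2 * i + 1) y).card)
    (hF : ∀ x < 2 * m, ∀ y < 2 * m, 3 * R + 3 ≤
      ((Finset.Ico c₂ m).filter fun i => r (2 * i) x ∧ r y (2 * i + 1)).card)
    {k : ℕ} (hk : 2 * (m - c) + 2 * ((badLinks r (c + 1) (m - 1)).card + 1) ≤ k)
    (hkm : k ≤ 2 * m) : HasCyclicList r (2 * m) k := by
  set B := (badLinks r (c + 1) (m - 1)).card with hB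
  obtain ⟨κ, hκ, hκ'⟩ := exists_connectors (c := c) (s := 2 * c) hbad hE (by omega) le_rfl (by omega)
  obtain ⟨h1, h2, h3, h4⟩ := connectorPlaces_spec (r := r) (s := 2 * c) (j := m) le_rfl (by omega)
    (by omega) hgood
  set Q := connectorPlaces r c m with hQ
  have hQcard : Q.card = B + 1 := card_connectorPlaces (by omega)
  have hBR : B ≤ R := (Finset.card_le_card (badLinks_mono (by omega) le_rfl)).trans hbad
  let X : Finset ℕ := Q.image (fun l => 2 * κ l) ∪ Q.image (fun l => 2 * κ l + 1)
  have hXcard : X.card ≤ 2 * (B + 1) := by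
    refine (Finset.card_union_le _ _).trans ?_
    have h1 := Finset.card_image_le (s := Q) (f := fun l => 2 * κ l)
    have h2 := Finset.card_image_le (s := Q) (f := fun l => 2 * κ l + 1)
    omega
  -- the vertices before the window that no connector uses
  let p : ℕ → Bool := fun x => decide (x ∉ X)
  let Λ : List ℕ := (List.range (2 * c)).filter p
  have hremoved : ((List.range (2 * c)).filter fun x => !p x).length ≤ 2 * (B + 1) := by
    rw [← List.toFinset_card_of_nodup (List.nodup_range.filter _)]
    refine (Finset.card_le_card ?_).trans hXcard
    intro x hx
    simpa [p] using (List.mem_filter.1 (List.mem_toFinset.1 hx)).2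
  have hΛlen : 2 * c ≤ Λ.length + 2 * (B + 1) := by
    have := List.length_eq_length_filter_add (l := List.range (2 * c)) p
    rw [List.length_range] at this
    simp only [Λ]
    omega
  have hΛbreak : breakCount r Λ ≤ R + 2 * (B + 1) := by
    have h1 := breakCount_filter_le r p (List.range (2 * c))
    have h2 := breakCount_range_two_mul_le (r := r) (m := m) (c := c) (by omega) hedge
    simp only [Λ]
    omega
  have hΛnd : Λ.Nodup := List.nodup_range.filter _
  obtain ⟨P, hP, hPc, hPlen⟩ := exists_flatten_isChain r
    (Λ.take (k - (2 * (m - c) + 2 * (B + 1))))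
  have hmemP : ∀ x ∈ P.flatten, x < 2 * c ∧ x ∉ X := by
    intro x hx
    rw [hP] at hx
    have := List.mem_filter.1 (List.mem_of_mem_take hx)
    simpa [p] using this
  have hPlen' : P.length ≤ 3 * R + 3 := by
    have := breakCount_take_le r Λ (k - (2 * (m - c) + 2 * (B + 1)))
    omega
  have hhead : ∀ q ∈ P, q.headI < 2 * m ∧ q.getLastI < 2 * m := by
    intro q hq
    have hmem : ∀ x ∈ q, x < 2 * m := fun x hx =>
      (hmemP x (List.mem_flatten_of_mem hq hx)).1.trans (by omega)
    have hne := (hPc q hq).1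
    constructor
    · cases q with
      | nil => exact absurd rfl hne
      | cons a q => exact hmem a List.mem_cons_self
    · rw [List.getLastI_eq_getLast?_getD, List.getLast?_eq_some_getLast hne]
      exact hmem _ (List.getLast_mem hne)
  obtain ⟨f, -, -, -, hf1, hf2, hf3, hf4⟩ := exists_placement (Finset.Ico c₂ m)
    (fun q => (Finset.Ico c₂ m).filter fun i => r (2 * i) q.headI ∧ r q.getLastI (2 * i + 1)) P
    (fun q hq => ⟨Finset.filter_subset _ _, hPlen'.trans (hF _ (hhead q hq).1 _ (hhead q hq).2)⟩)
    (by rw [hP]; exact hΛnd.sublist (List.take_sublist _ _))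
  have hfne : ∀ i, f i ≠ [] → i ∈ Finset.Ico c₂ m ∧
      (2 * i :: f i ++ [2 * i + 1]).IsChain r := by
    intro i hi
    obtain ⟨hmem, hO⟩ := hf1 i hi
    rw [Finset.mem_filter] at hO
    obtain ⟨hiF, hr1, hr2⟩ := hO
    refine ⟨hiF, ?_⟩
    have hch := (hPc _ hmem).2
    rw [List.cons_append, List.isChain_cons, List.isChain_append]
    refine ⟨?_, hch, by simp, ?_⟩
    · intro y hy
      cases hfi : f i with
      | nil => exact absurd hfi hi
      | cons a l =>
        rw [hfi] at hy hr1
        simp only [List.cons_append, List.head?_cons, Option.mem_def, Option.some.injEq] at hy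
        subst hy
        exact hr1
    · intro x hx y hy
      rw [List.getLastI_eq_getLast?_getD] at hr2
      rw [Option.mem_def] at hx
      simp only [List.head?_cons, Option.mem_def, Option.some.injEq] at hy
      rw [hx] at hr2
      subst hy
      exact hr2
  have key := hasCyclicList_of_connectors (le_refl (2 * c)) (by omega : 2 * c < 2 * m) le_rfl hedge
    Q h1 h2 h3 h4 κ hκ (fun l hl => (hκ' l hl).1.trans_le hc₁) (fun l hl => (hκ' l hl).2)
    (Finset.Ico c₂ m) (fun i hi => by rw [Finset.mem_Ico] at hi; omega) f hfne
    (fun i x hx => ⟨(hmemP x (hf3 i x hx)).1, fun l hl => ?_⟩) (fun i => ?_) hf2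
  · convert key using 1
    rw [hf4, hP, hQcard, List.length_take, min_eq_left (by omega)]
    omega
  · have hx' := (hmemP x (hf3 i x hx)).2
    simp only [X, Finset.mem_union, Finset.mem_image, not_or, not_exists, not_and] at hx'
    exact ⟨fun h => hx'.1 l hl h.symm, fun h => hx'.2 l hl h.symm⟩
  · by_cases hi : f i = []
    · simp [hi]
    · have : P.flatten.Nodup := by rw [hP]; exact hΛnd.sublist (List.take_sublist _ _)
      exact (List.nodup_flatten.1 this).1 _ (hf1 i hi).1

open Classical in
/-- Let `2 i, 2 i + 1` for `i < m` be the edges of an ordered perfect matching with at most `R` bad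
links, such that every two vertices can be connected through many of the edges in `[0, c₁)`, and
every piece can be absorbed by many of the edges in `[c₂, m)`. Then there are cycles of all lengths:
short ones from windows that start at `2 c`, long ones by absorbing the vertices below `2 c`. -/
theorem hasCyclicList_of_ordering (hedge : ∀ i < m, r (2 * i) (2 * i + 1))
    (hbad : (badLinks r 0 (m - 1)).card ≤ R) (hc₁ : c₁ ≤ c) (hc₂ : c < c₂) (hc₂m : c₂ < m)
    (hgood : r (2 * c + 1) (2 * c + 2))
    (hE : ∀ x < 2 * m, ∀ y < 2 * m, 3 * R + 3 ≤
      ((Finset.range c₁).filter fun i => r x (2 * i) ∧ r (2 * i + 1) y).card)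
    (hF : ∀ x < 2 * m, ∀ y < 2 * m, 3 * R + 3 ≤
      ((Finset.Ico c₂ m).filter fun i => r (2 * i) x ∧ r y (2 * i + 1)).card)
    {k : ℕ} (hk3 : 3 ≤ k) (hkm : k ≤ 2 * m) : HasCyclicList r (2 * m) k := by
  let T : ℕ → ℕ := fun j => 2 * (j - c) + 2 * ((badLinks r (c + 1) (j - 1)).card + 1)
  by_cases hkT : k < T m
  · have hex : ∃ j, c < j ∧ k ≤ T j := ⟨m, by omega, hkT.le⟩
    obtain ⟨hcj, hkj⟩ := Nat.find_spec hex
    have hjm : Nat.find hex ≤ m := Nat.find_min' hex ⟨by omega, hkT.le⟩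
    have hmin := fun j hj => Nat.find_min hex (m := j) hj
    generalize Nat.find hex = j at *
    have hTj : T j = 2 * (j - c) + 2 * ((badLinks r (c + 1) (j - 1)).card + 1) := rfl
    -- `δ` vertices are dropped at the start of the window `[2 c, 2 j)`
    obtain ⟨δ, hδ, hδ3, hδj⟩ : ∃ δ, k + δ = T j ∧ δ ≤ 3 ∧ 2 * c + δ < 2 * j := by
      refine ⟨T j - k, by omega, ?_⟩
      rcases (show c + 1 ≤ j by omega).eq_or_lt with rfl | h
      · have : badLinks r (c + 1) (c + 1 - 1) = ∅ := by
          apply Finset.eq_empty_of_forall_notMem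
          intro i hi
          have := (mem_badLinks.1 hi).1
          omega
        rw [this, Finset.card_empty] at hTj
        omega
      · have hT : T (j - 1) < k := by
          have := hmin (j - 1) (by omega)
          push Not at this
          exact this (by omega)
        have hTj' : T (j - 1) =
          2 * (j - 1 - c) + 2 * ((badLinks r (c + 1) (j - 1 - 1)).card + 1) := rfl
        have hs := card_badLinks_succ_le (r := r) (c + 1) (j - 1 - 1)
        rw [Nat.sub_add_cancel (by omega)] at hs
        omega
    have := hasCyclicList_window hedge hbad hc₁ hgood hE (s := 2 * c + δ) (j := j) (by omega)
      (by omega) hδj hjm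
    convert this using 1
    omega
  · exact hasCyclicList_absorb hedge hbad hc₁ hc₂ hc₂m hgood hE hF (not_lt.1 hkT) hkm

end Lengths

/-! ### Cyclic lists and cycles in graphs -/

section Graph

variable {V : Type*} {Γ : SimpleGraph V}

theorem HasCyclicList.exists_cycle {w : ℕ → V} {n k : ℕ} (hk : 3 ≤ k)
    (hw : Set.InjOn w (Set.Iio n)) (h : HasCyclicList (fun i j => Γ.Adj (w i) (w j)) n k) :
    ∃ (v : V) (c : Γ.Walk v v), c.IsCycle ∧ c.length = k := by
  obtain ⟨s, L, hnd, hlt, hch, hlen⟩ := h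
  rw [← SimpleGraph.cycleGraph_isContained_iff (by omega)]
  have hadj : ∀ i (hi : i < k), Γ.Adj (w ((s :: L)[i]'(by omega)))
      (w ((s :: L)[(i + 1) % k]'(by rw [hlen]; exact Nat.mod_lt _ (by omega)))) := by
    intro i hi
    have h1 := List.isChain_iff_getElem.1 hch i (by simp at hlen ⊢; omega)
    rw [List.getElem_append_left (by omega)] at h1
    rcases (show i + 1 ≤ k by omega).eq_or_lt with h | h
    · simp only [h, Nat.mod_self]
      rw [List.getElem_append_right (by omega)] at h1
      simpa using h1
    · simp only [Nat.mod_eq_of_lt h]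
      rwa [List.getElem_append_left (by omega)] at h1
  refine ⟨⟨⟨fun i : Fin k => w ((s :: L)[i.val]'(by omega)), ?_⟩, ?_⟩⟩
  · have aux : ∀ a b : Fin k, (a - b).val = 1 → Γ.Adj (w ((s :: L)[b.val]'(by omega)))
        (w ((s :: L)[a.val]'(by omega))) := by
      intro a b hab
      have : a.val = (b.val + 1) % k := by
        rw [Fin.sub_def] at hab
        simp only at hab
        rcases le_total b.val a.val with h | h
        · have : k - b.val + a.val = (a.val - b.val) + k := by omega
          rw [this, Nat.add_mod_right, Nat.mod_eq_of_lt (by omega)] at hab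
          rw [Nat.mod_eq_of_lt (by omega)]
          omega
        · rcases h.eq_or_lt with h | h
          · rw [h, Nat.sub_add_cancel (by omega), Nat.mod_self] at hab
            omega
          · rw [Nat.mod_eq_of_lt (by omega)] at hab
            rw [show b.val + 1 = k by omega, Nat.mod_self]
            omega
      have h2 := hadj b.val b.2
      simpa only [← this] using h2
    intro a b hab
    rw [SimpleGraph.cycleGraph_adj'] at hab
    rcases hab with h | h
    · exact (aux a b h).symm
    · exact aux b a h
  · intro a b hab
    have := hw (hlt _ (List.getElem_mem _)) (hlt _ (List.getElem_mem _)) hab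
    exact Fin.ext ((List.Nodup.getElem_inj_iff hnd).1 this)

end Graph

/-! ### Pair counts of random permutations -/

section PairCount

open Equiv

variable {m : ℕ}

theorem exists_perm_apply_eq_and {α : Type*} [DecidableEq α] {a b a' b' : α} (h : a ≠ b)
    (h' : a' ≠ b') : ∃ σ : Perm α, σ a = a' ∧ σ b = b' := by
  refine ⟨swap (swap a a' b) b' * swap a a', ?_, ?_⟩
  · rw [Perm.mul_apply, swap_apply_left, swap_apply_of_ne_of_ne _ h']
    intro hb
    apply h
    rw [← (swap a a').injective.eq_iff, swap_apply_left]
    exact hb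
  · rw [Perm.mul_apply, swap_apply_left]

open Classical in
/-- Two different numbers are sent into sets `A` and `B` of size at least `a` by a proportion of at
least `a (a - 1) / m²` of all permutations of `Fin m`. -/
theorem factorial_mul_le_card_perm_mul {A B : Finset (Fin m)} {a : ℕ} (hA : a ≤ A.card)
    (hB : a ≤ B.card) {u v : Fin m} (huv : u ≠ v) :
    m.factorial * (a * (a - 1)) ≤
      ({π : Perm (Fin m) | π u ∈ A ∧ π v ∈ B} : Finset (Perm (Fin m))).card * m ^ 2 := by
  set N : Fin m × Fin m → ℕ := fun z =>
    ({π : Perm (Fin m) | π z.1 ∈ A ∧ π z.2 ∈ B} : Finset (Perm (Fin m))).card with hN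
  set S : Finset (Fin m × Fin m) := (Finset.univ : Finset (Fin m)).offDiag with hS
  have hconst : ∀ z ∈ S, N z = N (u, v) := by
    rintro ⟨x, y⟩ hz
    have hxy : x ≠ y := by simpa [hS] using hz
    obtain ⟨σ, rfl, rfl⟩ := exists_perm_apply_eq_and huv hxy
    refine Finset.card_bij (fun π _ => π * σ) ?_ ?_ ?_
    · intro π hπ
      simpa using hπ
    · intro π _ π' _ h
      exact mul_right_cancel h
    · intro π hπ
      exact ⟨π * σ⁻¹, by simpa using hπ, by simp⟩
  have hsum : ∑ z ∈ S, N z = ∑ π : Perm (Fin m),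
      (S.filter fun z => π z.1 ∈ A ∧ π z.2 ∈ B).card := by
    have := Finset.sum_card_bipartiteAbove_eq_sum_card_bipartiteBelow
      (s := S) (t := (Finset.univ : Finset (Perm (Fin m))))
      (fun z π => π z.1 ∈ A ∧ π z.2 ∈ B)
    simpa [Finset.bipartiteAbove, Finset.bipartiteBelow, hN] using this
  have hπ : ∀ π : Perm (Fin m), a * (a - 1) ≤
      (S.filter fun z => π z.1 ∈ A ∧ π z.2 ∈ B).card := by
    intro π
    have h1 : (A.sigma fun x => B.erase x).card ≤
        (S.filter fun z => π z.1 ∈ A ∧ π z.2 ∈ B).card := by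
      refine Finset.card_le_card_of_injOn (fun z => (π⁻¹ z.1, π⁻¹ z.2)) ?_ ?_
      · rintro ⟨x, y⟩ hxy
        simp only [Finset.coe_sigma, Set.mem_sigma_iff, Finset.mem_coe, Finset.mem_erase] at hxy
        simp only [hS, Finset.coe_filter, Finset.mem_offDiag, Finset.mem_univ, true_and,
          Set.mem_ofPred_eq]
        exact ⟨fun h => hxy.2.1 (π⁻¹.injective h).symm, by simpa using hxy.1, by simpa using hxy.2.2⟩
      · rintro ⟨x, y⟩ _ ⟨x', y'⟩ _ h
        simpa using h
    refine le_trans ?_ h1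
    rw [Finset.card_sigma]
    calc a * (a - 1) ≤ ∑ _x ∈ A, (a - 1) := by
          rw [Finset.sum_const, smul_eq_mul]
          exact Nat.mul_le_mul_right _ hA
      _ ≤ ∑ x ∈ A, (B.erase x).card := by
          refine Finset.sum_le_sum fun x _ => ?_
          have := Finset.pred_card_le_card_erase (s := B) (a := x)
          omega
  have hScard : S.card ≤ m ^ 2 := by
    rw [hS, Finset.offDiag_card]
    simp only [Finset.card_univ, Fintype.card_fin]
    rw [sq]
    omega
  calc m.factorial * (a * (a - 1)) = ∑ _π : Perm (Fin m), a * (a - 1) := by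
        simp [Fintype.card_perm]
    _ ≤ ∑ z ∈ S, N z := hsum ▸ Finset.sum_le_sum fun π _ => hπ π
    _ = S.card * N (u, v) := by rw [Finset.sum_congr rfl hconst, Finset.sum_const, smul_eq_mul]
    _ ≤ N (u, v) * m ^ 2 := by rw [mul_comm]; exact Nat.mul_le_mul_left _ hScard

open Classical in
/-- The number of pairs `(p i, q i)`, for `i ∈ I`, that the permutation `π` of the first coordinates
sends into `A × B`. -/
noncomputable def pairCount (I : Finset ℕ) (p q : ℕ → Fin m × Bool) (A B : Set (Fin m × Bool))
    (π : Perm (Fin m)) : ℕ :=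
  (I.filter fun i => (π (p i).1, (p i).2) ∈ A ∧ (π (q i).1, (q i).2) ∈ B).card

variable {I : Finset ℕ} {p q : ℕ → Fin m × Bool} {A B : Set (Fin m × Bool)}

open Classical in
theorem card_filter_apply_mem_pair_le (hp : Set.InjOn p I) (π : Perm (Fin m)) (u v : Fin m) :
    (I.filter fun i => π (p i).1 = u ∨ π (p i).1 = v).card ≤ 4 := by
  have h : (I.filter fun i => π (p i).1 = u ∨ π (p i).1 = v).card ≤
      ((({π⁻¹ u, π⁻¹ v} : Finset (Fin m))) ×ˢ (Finset.univ : Finset Bool)).card := by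
    refine Finset.card_le_card_of_injOn p ?_ (hp.mono fun i hi => (Finset.mem_filter.1 hi).1)
    intro i hi
    have hi := (Finset.mem_filter.1 hi).2
    simp only [Finset.mem_coe, Finset.mem_product, Finset.mem_insert, Finset.mem_singleton,
      Finset.mem_univ, and_true]
    rcases hi with h | h
    · exact Or.inl (by rw [← h]; simp)
    · exact Or.inr (by rw [← h]; simp)
  refine h.trans ?_
  rw [Finset.card_product]
  have := Finset.card_le_two (a := π⁻¹ u) (b := π⁻¹ v)
  simp only [Finset.card_univ, Fintype.card_bool]
  omega

/-- A transposition affects the images of four labels only, each of which occurs at most once in `p`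
and once in `q`. -/
theorem pairCount_swap_mul_le (hp : Set.InjOn p I) (hq : Set.InjOn q I) (u v : Fin m)
    (π : Perm (Fin m)) : pairCount I p q A B (swap u v * π) ≤ pairCount I p q A B π + 8 := by
  classical
  have h1 := card_filter_apply_mem_pair_le hp π u v
  have h2 := card_filter_apply_mem_pair_le hq π u v
  unfold pairCount
  set S := I.filter fun i => π (p i).1 = u ∨ π (p i).1 = v
  set S' := I.filter fun i => π (q i).1 = u ∨ π (q i).1 = v
  refine (Finset.card_le_card (t := (I.filter fun i => (π (p i).1, (p i).2) ∈ A ∧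
    (π (q i).1, (q i).2) ∈ B) ∪ (S ∪ S')) ?_).trans ?_
  · intro i hi
    rw [Finset.mem_filter] at hi
    by_cases hS : i ∈ S
    · simp [hS]
    by_cases hS' : i ∈ S'
    · simp [hS']
    simp only [S, S', Finset.mem_filter, hi.1, true_and, not_or] at hS hS'
    rw [Perm.mul_apply, Perm.mul_apply, swap_apply_of_ne_of_ne hS.1 hS.2,
      swap_apply_of_ne_of_ne hS'.1 hS'.2] at hi
    exact Finset.mem_union_left _ (Finset.mem_filter.2 hi)
  · refine (Finset.card_union_le _ _).trans ?_
    have := Finset.card_union_le S S'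
    omega

theorem abs_pairCount_swap_mul_sub_le (hp : Set.InjOn p I) (hq : Set.InjOn q I) (u v : Fin m)
    (π : Perm (Fin m)) :
    |(pairCount I p q A B (swap u v * π) : ℝ) - pairCount I p q A B π| ≤ 8 := by
  have h1 := pairCount_swap_mul_le (A := A) (B := B) hp hq u v π
  have h2 := pairCount_swap_mul_le (A := A) (B := B) hp hq u v (swap u v * π)
  rw [← mul_assoc, swap_mul_self, one_mul] at h2
  rw [abs_le]
  constructor
  · have : (pairCount I p q A B π : ℝ) ≤ pairCount I p q A B (swap u v * π) + 8 := by
      exact_mod_cast h2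
    linarith
  · have : (pairCount I p q A B (swap u v * π) : ℝ) ≤ pairCount I p q A B π + 8 := by
      exact_mod_cast h1
    linarith

open Classical in
/-- The mean of the pair count. Indices `i` for which `p i` and `q i` have the same first
coordinate are discarded, because their images are dependent. -/
theorem factorial_mul_le_sum_pairCount_mul {a D : ℕ}
    (hA : ∀ s, a ≤ ({u | (u, s) ∈ A} : Finset (Fin m)).card)
    (hB : ∀ s, a ≤ ({u | (u, s) ∈ B} : Finset (Fin m)).card)
    (hD : (I.filter fun i => (p i).1 = (q i).1).card ≤ D) :
    (I.card - D) * (m.factorial * (a * (a - 1))) ≤ (∑ π, pairCount I p q A B π) * m ^ 2 := by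
  have hsum : ∑ π, pairCount I p q A B π = ∑ i ∈ I, ({π : Perm (Fin m) |
      (π (p i).1, (p i).2) ∈ A ∧ (π (q i).1, (q i).2) ∈ B} : Finset (Perm (Fin m))).card := by
    have := Finset.sum_card_bipartiteAbove_eq_sum_card_bipartiteBelow
      (s := (Finset.univ : Finset (Perm (Fin m)))) (t := I)
      (fun π i => (π (p i).1, (p i).2) ∈ A ∧ (π (q i).1, (q i).2) ∈ B)
    simpa [Finset.bipartiteAbove, Finset.bipartiteBelow, pairCount] using this
  rw [hsum, Finset.sum_mul]
  have hcard : I.card - D ≤ (I.filter fun i => ¬ (p i).1 = (q i).1).card := by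
    have := Finset.card_filter_add_card_filter_not (s := I) (fun i => (p i).1 = (q i).1)
    omega
  calc (I.card - D) * (m.factorial * (a * (a - 1)))
      ≤ ∑ _i ∈ I.filter (fun i => ¬ (p i).1 = (q i).1), m.factorial * (a * (a - 1)) := by
        rw [Finset.sum_const, smul_eq_mul]
        exact Nat.mul_le_mul_right _ hcard
    _ ≤ ∑ i ∈ I.filter (fun i => ¬ (p i).1 = (q i).1), ({π : Perm (Fin m) |
          (π (p i).1, (p i).2) ∈ A ∧ (π (q i).1, (q i).2) ∈ B} : Finset (Perm (Fin m))).card *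
            m ^ 2 := by
        refine Finset.sum_le_sum fun i hi => ?_
        have := factorial_mul_le_card_perm_mul (hA (p i).2) (hB (q i).2) (Finset.mem_filter.1 hi).2
        simpa using this
    _ ≤ _ := Finset.sum_le_sum_of_subset (Finset.filter_subset _ _)

open Classical in
/-- For most permutations `π`, at least half of the expected number of pairs is sent into
`A × B`. -/
theorem card_pairCount_le {a : ℕ} (ha : 1 ≤ a) (hm : 0 < m) (hp : Set.InjOn p I)
    (hq : Set.InjOn q I)
    (hA : ∀ s, a ≤ ({u | (u, s) ∈ A} : Finset (Fin m)).card)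
    (hB : ∀ s, a ≤ ({u | (u, s) ∈ B} : Finset (Fin m)).card)
    (hD : (m : ℝ) / 8 ≤ I.card - (I.filter fun i => (p i).1 = (q i).1).card) {κ : ℝ}
    (hκ : κ = a * (a - 1) / (16 * m)) :
    (({π | (pairCount I p q A B π : ℝ) ≤ κ} : Finset (Perm (Fin m))).card : ℝ) ≤
      m.factorial * Real.exp (-(κ ^ 2 / (512 * m))) := by
  have hm' : (0 : ℝ) < m := by exact_mod_cast hm
  have ha' : (1 : ℝ) ≤ a := by exact_mod_cast ha
  have hκ0 : 0 ≤ κ := by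
    rw [hκ]
    have : (0 : ℝ) ≤ a - 1 := by linarith
    positivity
  have hfac : (0 : ℝ) < m.factorial := by exact_mod_cast m.factorial_pos
  set f : Perm (Fin m) → ℝ := fun π => pairCount I p q A B π
  have hmean : 2 * κ ≤ (∑ π, f π) / m.factorial := by
    have h := factorial_mul_le_sum_pairCount_mul (I := I) (p := p) (q := q) hA hB le_rfl
    have hle : (I.filter fun i => (p i).1 = (q i).1).card ≤ I.card := Finset.card_filter_le _ _
    have h' : ((I.card : ℝ) - (I.filter fun i => (p i).1 = (q i).1).card) *
        (m.factorial * (a * (a - 1))) ≤ (∑ π, f π) * m ^ 2 := by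
      have := (Nat.cast_le (α := ℝ)).2 h
      rw [Nat.cast_mul, Nat.cast_sub hle] at this
      push_cast [Nat.cast_sub ha] at this
      exact this
    have h0 : (0 : ℝ) ≤ m.factorial * (a * (a - 1)) := by
      have : (0 : ℝ) ≤ a - 1 := by linarith
      positivity
    have h2 := (mul_le_mul_of_nonneg_right hD h0).trans h'
    rw [le_div_iff₀ hfac, hκ]
    have h3 : (m : ℝ) * (m.factorial * (a * (a - 1)) / 8) ≤ m * ((∑ π, f π) * m) := by
      nlinarith
    have h4 := le_of_mul_le_mul_left h3 hm'
    rw [show 2 * ((a : ℝ) * (a - 1) / (16 * m)) * m.factorial =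
      (m.factorial * (a * (a - 1)) / 8) / m by field_simp; ring]
    rwa [div_le_iff₀ hm']
  have h := card_perm_le_sub_le hm f 8 κ (by norm_num) hκ0
    (fun i j π => abs_pairCount_swap_mul_sub_le hp hq i j π)
  have hexp : κ ^ 2 / (8 * m * 8 ^ 2) = κ ^ 2 / (512 * m) := by ring
  rw [hexp] at h
  refine le_trans ?_ h
  rw [Nat.cast_le]
  refine Finset.card_le_card fun π hπ => ?_
  rw [Finset.mem_filter] at hπ ⊢
  refine ⟨hπ.1, ?_⟩
  have := hπ.2
  simp only [f] at hmean ⊢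
  linarith

end PairCount

/-! ### Balanced labellings -/

section Labelling

open Classical in
/-- Hoeffding's inequality for the lower tail of a signed sum with random signs. -/
theorem card_sum_sign_le {m : ℕ} (c : Fin m → ℝ) (hc : ∀ u, |c u| ≤ 1) {t : ℝ} (ht : 0 ≤ t) :
    (({ε | ∑ u, (if ε u then 1 else -1) * c u ≤ -t} : Finset (Fin m → Bool)).card : ℝ) ≤
      2 ^ m * Real.exp (-(t ^ 2 / (2 * m))) := by
  rcases Nat.eq_zero_or_pos m with rfl | hm
  · simpa using Finset.card_le_univ
      ({ε | ∑ u, (if ε u then 1 else -1) * c u ≤ -t} : Finset (Fin 0 → Bool))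
  have hm' : (0 : ℝ) < m := by exact_mod_cast hm
  set S : Finset (Fin m → Bool) := {ε | ∑ u, (if ε u then 1 else -1) * c u ≤ -t}
  set b : ℝ := t / m with hb
  have hmgf : ∑ ε : Fin m → Bool, Real.exp (-b * ∑ u, (if ε u then 1 else -1) * c u) ≤
      2 ^ m * Real.exp (m * (b ^ 2 / 2)) := by
    calc ∑ ε : Fin m → Bool, Real.exp (-b * ∑ u, (if ε u then 1 else -1) * c u)
        = ∑ ε : Fin m → Bool, ∏ u, Real.exp (-b * ((if ε u then 1 else -1) * c u)) := by
          refine Finset.sum_congr rfl fun ε _ => ?_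
          rw [Finset.mul_sum, Real.exp_sum]
      _ = ∏ u, ∑ s : Bool, Real.exp (-b * ((if s then 1 else -1) * c u)) := by
          have := Finset.prod_univ_sum (fun _ : Fin m => (Finset.univ : Finset Bool))
            (fun u s => Real.exp (-b * ((if s then 1 else -1) * c u)))
          rw [this, Fintype.piFinset_univ]
      _ ≤ ∏ _u : Fin m, 2 * Real.exp (b ^ 2 / 2) := by
          refine Finset.prod_le_prod (fun u _ => Finset.sum_nonneg fun s _ => (Real.exp_pos _).le)
            fun u _ => ?_
          have h1 := Real.cosh_le_exp_half_sq (b * c u)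
          rw [Real.cosh_eq] at h1
          have h2 : Real.exp ((b * c u) ^ 2 / 2) ≤ Real.exp (b ^ 2 / 2) := by
            apply Real.exp_le_exp.2
            have : (c u) ^ 2 ≤ 1 := (sq_le_one_iff_abs_le_one _).2 (hc u)
            nlinarith [sq_nonneg b]
          simp only [Fintype.sum_bool, if_true, Bool.false_eq_true, if_false]
          have e1 : -b * (1 * c u) = -(b * c u) := by ring
          have e2 : -b * (-1 * c u) = b * c u := by ring
          rw [e1, e2]
          linarith
      _ = _ := by
          rw [Finset.prod_const, mul_pow, ← Real.exp_nat_mul]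
          simp
  have h1 : (S.card : ℝ) * Real.exp (b * t) ≤ 2 ^ m * Real.exp (m * (b ^ 2 / 2)) := by
    refine le_trans ?_ hmgf
    rw [← nsmul_eq_mul, ← Finset.sum_const]
    refine (Finset.sum_le_sum (fun ε hε => ?_)).trans
      (Finset.sum_le_sum_of_subset_of_nonneg (Finset.subset_univ S) fun _ _ _ => (Real.exp_pos _).le)
    have := (Finset.mem_filter.1 hε).2
    have hb0 : 0 ≤ b := by positivity
    apply Real.exp_le_exp.2
    nlinarith
  have h2 : (S.card : ℝ) ≤ 2 ^ m * Real.exp (m * (b ^ 2 / 2)) * Real.exp (-(b * t)) := by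
    rw [Real.exp_neg, ← div_eq_mul_inv, le_div_iff₀ (Real.exp_pos _)]
    exact h1
  refine h2.trans_eq ?_
  rw [mul_assoc, ← Real.exp_add]
  congr 2
  rw [hb]
  field_simp
  ring

/-- A matching involution is conjugate to the flip of the second coordinate of `Fin m × Bool`. -/
theorem IsMatchingInvolution.exists_labelling {V : Type*} [Fintype V] [LinearOrder V]
    {τ : Equiv.Perm V} (hτ : IsMatchingInvolution τ) {m : ℕ} (hm : Fintype.card V = 2 * m) :
    ∃ e : V ≃ Fin m × Bool, ∀ v, e (τ v) = ((e v).1, !(e v).2) := by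
  classical
  have hlt : ∀ v, ¬ v < τ v → τ v < τ (τ v) := by
    intro v hv
    rw [(hτ v).1]
    exact lt_of_le_of_ne (not_lt.1 hv) (hτ v).2
  let e₀ : V ≃ {v : V // v < τ v} × Bool :=
    { toFun := fun v => if h : v < τ v then (⟨v, h⟩, true) else (⟨τ v, hlt v h⟩, false)
      invFun := fun z => if z.2 then z.1.1 else τ z.1.1
      left_inv := by
        intro v
        by_cases h : v < τ v
        · simp [h]
        · simp [h, (hτ v).1]
      right_inv := by
        rintro ⟨⟨v, hv⟩, s⟩
        cases s
        · have : ¬ τ v < τ (τ v) := by rw [(hτ v).1]; exact hv.not_gt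
          simp only [Bool.false_eq_true, if_false]
          rw [dif_neg this]
          simp [(hτ v).1]
        · simp [hv] }
  have hcard : Fintype.card {v : V // v < τ v} = m := by
    have := Fintype.card_congr e₀
    rw [hm, Fintype.card_prod, Fintype.card_bool] at this
    omega
  refine ⟨e₀.trans ((Fintype.equivFinOfCardEq hcard).prodCongr (Equiv.refl _)), fun v => ?_⟩
  by_cases h : v < τ v
  · have h' : ¬ τ v < τ (τ v) := by rw [(hτ v).1]; exact h.not_gt
    have h1 : e₀ v = (⟨v, h⟩, true) := dif_pos h
    have h2 : e₀ (τ v) = (⟨v, h⟩, false) := by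
      refine (dif_neg h').trans ?_
      simp [(hτ v).1]
    simp [h1, h2]
  · simp [e₀, h, hlt v h]

open Classical in
/-- The edges of a matching can be oriented so that about half of each of the sets `N x` consists of
starts, and about half of ends; `e` numbers the edges and records the orientation. -/
theorem IsMatchingInvolution.exists_balanced_labelling {V : Type*} [Fintype V] [LinearOrder V]
    {τ : Equiv.Perm V} (hτ : IsMatchingInvolution τ) {m : ℕ} (hm : Fintype.card V = 2 * m)
    (N : V → Set V) {d : ℝ} (hd0 : 0 ≤ d) (hd : ∀ x, d ≤ ({v | v ∈ N x} : Finset V).card)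
    (hsmall : 4 * m * Real.exp (-(d ^ 2 / (8 * m))) < 1) :
    ∃ e : V ≃ Fin m × Bool, (∀ v, e (τ v) = ((e v).1, !(e v).2)) ∧
      ∀ x s, d / 4 ≤ ({u | e.symm (u, s) ∈ N x} : Finset (Fin m)).card := by
  obtain ⟨e₀, he₀⟩ := hτ.exists_labelling hm
  let ind : V → Fin m → Bool → ℝ := fun x u s => if e₀.symm (u, s) ∈ N x then 1 else 0
  let c : V → Fin m → ℝ := fun x u => ind x u true - ind x u false
  have hc : ∀ x u, |c x u| ≤ 1 := by
    intro x u
    simp only [c, ind]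
    split_ifs <;> norm_num
  have hc' : ∀ x u, |(-c x) u| ≤ 1 := fun x u => by simpa using hc x u
  let S₁ : V → Finset (Fin m → Bool) := fun x =>
    {ε | ∑ u, (if ε u then 1 else -1) * c x u ≤ -(d / 2)}
  let S₂ : V → Finset (Fin m → Bool) := fun x =>
    {ε | ∑ u, (if ε u then 1 else -1) * (-c x) u ≤ -(d / 2)}
  have hE : (d / 2) ^ 2 / (2 * m) = d ^ 2 / (8 * m) := by ring
  have h1 : ∀ x, ((S₁ x).card : ℝ) ≤ 2 ^ m * Real.exp (-(d ^ 2 / (8 * m))) := fun x => by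
    rw [← hE]; exact card_sum_sign_le (c x) (hc x) (by positivity)
  have h2 : ∀ x, ((S₂ x).card : ℝ) ≤ 2 ^ m * Real.exp (-(d ^ 2 / (8 * m))) := fun x => by
    rw [← hE]; exact card_sum_sign_le (-c x) (hc' x) (by positivity)
  obtain ⟨ε, hε⟩ : ∃ ε : Fin m → Bool, ∀ x, ε ∉ S₁ x ∧ ε ∉ S₂ x := by
    by_contra! hcon
    have hcover : (Finset.univ : Finset (Fin m → Bool)) ⊆
        Finset.univ.biUnion fun x => S₁ x ∪ S₂ x := by
      intro ε _
      obtain ⟨x, hx⟩ := hcon ε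
      rw [Finset.mem_biUnion]
      refine ⟨x, Finset.mem_univ x, ?_⟩
      rw [Finset.mem_union]
      by_cases h : ε ∈ S₁ x
      · exact Or.inl h
      · exact Or.inr (hx h)
    have hle := (Finset.card_le_card hcover).trans Finset.card_biUnion_le
    rw [Finset.card_univ, Fintype.card_pi] at hle
    simp only [Fintype.card_bool, Finset.prod_const, Finset.card_univ, Fintype.card_fin] at hle
    have hle' : (2 : ℝ) ^ m ≤ ∑ x : V, (((S₁ x).card : ℝ) + (S₂ x).card) := by
      have h3 : (2 : ℝ) ^ m ≤ ∑ x : V, ((S₁ x ∪ S₂ x).card : ℝ) := by exact_mod_cast hle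
      refine h3.trans (Finset.sum_le_sum fun x _ => ?_)
      exact_mod_cast Finset.card_union_le _ _
    have hle2 := hle'.trans (Finset.sum_le_sum fun x _ => add_le_add (h1 x) (h2 x))
    rw [Finset.sum_const, Finset.card_univ, hm, nsmul_eq_mul] at hle2
    push_cast at hle2
    have h2m : (0 : ℝ) < 2 ^ m := by positivity
    nlinarith
  let σ : Fin m × Bool ≃ Fin m × Bool :=
    { toFun := fun z => (z.1, xor z.2 (ε z.1))
      invFun := fun z => (z.1, xor z.2 (ε z.1))
      left_inv := by rintro ⟨u, s⟩; simp
      right_inv := by rintro ⟨u, s⟩; simp }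
  refine ⟨e₀.trans σ, fun v => ?_, fun x s => ?_⟩
  · simp [σ, he₀]
  · have hcard : ∀ s, (({u | (e₀.trans σ).symm (u, s) ∈ N x} : Finset (Fin m)).card : ℝ) =
        ∑ u, ind x u (xor s (ε u)) := by
      intro s
      rw [Finset.card_filter]
      push_cast
      rfl
    have hNx : (({v | v ∈ N x} : Finset V).card : ℝ) = ∑ u, (ind x u true + ind x u false) := by
      rw [Finset.card_filter, ← e₀.symm.sum_comp, Fintype.sum_prod_type]
      push_cast
      refine Finset.sum_congr rfl fun u _ => ?_
      rw [Fintype.sum_bool]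
    have hsgn₁ := (hε x).1
    have hsgn₂ := (hε x).2
    simp only [S₁, S₂, Finset.mem_filter, Finset.mem_univ, true_and, not_le, Pi.neg_apply,
      mul_neg, Finset.sum_neg_distrib] at hsgn₁ hsgn₂
    have hdx := hd x
    rw [hNx] at hdx
    have hdiff : ∑ u, (if ε u then 1 else -1) * c x u =
        ∑ u, ind x u (xor false (ε u)) - ∑ u, ind x u (xor true (ε u)) := by
      rw [← Finset.sum_sub_distrib]
      refine Finset.sum_congr rfl fun u _ => ?_
      cases ε u <;> simp [c]
    have hadd : ∑ u, (ind x u true + ind x u false) =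
        ∑ u, ind x u (xor false (ε u)) + ∑ u, ind x u (xor true (ε u)) := by
      rw [← Finset.sum_add_distrib]
      refine Finset.sum_congr rfl fun u _ => ?_
      cases ε u <;> simp [add_comm]
    rw [hdiff] at hsgn₁ hsgn₂
    rw [hadd] at hdx
    rw [hcard s]
    cases s <;> linarith

theorem exists_isMatchingInvolution {α : Type*} [Fintype α] (h : Even (Fintype.card α)) :
    ∃ σ : Equiv.Perm α, IsMatchingInvolution σ := by
  obtain ⟨k, hk⟩ := h
  have e : α ≃ Fin k × Bool := Fintype.equivOfCardEq (by simp [hk]; ring)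
  refine ⟨(e.trans ((Equiv.refl _).prodCongr Equiv.boolNot)).trans e.symm, fun v => ⟨?_, ?_⟩⟩
  · rw [← e.injective.eq_iff]
    ext <;> simp
  intro h
  have := congrArg (fun v => (e v).2) h
  simp at this

open Classical in
/-- A matching `M` of a graph on an even number of vertices extends to a pairing of all vertices, in
which only vertices that `M` does not cover may be paired with non-neighbours. -/
theorem SimpleGraph.Subgraph.IsMatching.exists_isMatchingInvolution {V : Type*} [Fintype V]
    {H : SimpleGraph V} {M : H.Subgraph} (hM : M.IsMatching) (hV : Even (Fintype.card V)) :
    ∃ τ : Equiv.Perm V, IsMatchingInvolution τ ∧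
      ({v | ¬ H.Adj v (τ v)} : Finset V).card + M.verts.ncard ≤ Fintype.card V := by
  have hcard : Fintype.card {v // v ∉ M.verts} + M.verts.ncard = Fintype.card V := by
    rw [Fintype.card_subtype_compl, Set.ncard_eq_toFinset_card', Set.toFinset_card]
    have := Fintype.card_subtype_le (fun v => v ∈ M.verts)
    exact Nat.sub_add_cancel this
  have hevenM : Even M.verts.ncard := by
    rw [Set.ncard_eq_toFinset_card']
    exact hM.even_card
  have heven : Even (Fintype.card {v // v ∉ M.verts}) := by
    rw [← hcard, Nat.even_add] at hV
    exact hV.2 hevenM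
  obtain ⟨σ, hσ⟩ := _root_.exists_isMatchingInvolution heven
  have hex : ∀ v (hv : v ∈ M.verts), ∃ u, M.Adj v u := fun v hv => (hM hv).exists
  let f : V → V := fun v => if hv : v ∈ M.verts then (hex v hv).choose else σ ⟨v, hv⟩
  have hfM : ∀ v (_ : v ∈ M.verts), M.Adj v (f v) := by
    intro v hv
    simp only [f, hv, dif_pos]
    exact (hex v hv).choose_spec
  have hfσ : ∀ v (hv : v ∉ M.verts), f v = σ ⟨v, hv⟩ := by
    intro v hv
    simp [f, hv]
  have hinv : Function.Involutive f := by
    intro v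
    by_cases hv : v ∈ M.verts
    · have h1 := hfM v hv
      have h2 := hfM (f v) h1.snd_mem
      exact (hM h1.snd_mem).unique h2 h1.symm
    · rw [hfσ v hv, hfσ _ (σ ⟨v, hv⟩).2]
      simp [(hσ ⟨v, hv⟩).1]
  refine ⟨hinv.toPerm, fun v => ⟨hinv v, ?_⟩, ?_⟩
  · rw [Function.Involutive.coe_toPerm]
    by_cases hv : v ∈ M.verts
    · exact (hfM v hv).ne.symm
    · rw [hfσ v hv]
      intro h
      exact (hσ ⟨v, hv⟩).2 (Subtype.ext h)
  · rw [← hcard]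
    refine Nat.add_le_add_right ?_ _
    rw [Fintype.card_subtype]
    refine Finset.card_le_card fun v hv => ?_
    rw [Finset.mem_filter] at hv ⊢
    exact ⟨hv.1, fun h => hv.2 (hfM v h).adj_sub⟩

end Labelling

/-! ### Relabelled matchings -/

section Conjugation

variable {V : Type*}

/-- The graph in which each vertex is joined to its image under `γ`. -/
def matchingGraph (γ : Equiv.Perm V) : SimpleGraph V :=
  SimpleGraph.fromRel fun u v => γ u = v

theorem matchingGraph_adj {γ : Equiv.Perm V} (hγ : IsMatchingInvolution γ) {u v : V} :
    (matchingGraph γ).Adj u v ↔ γ u = v := by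
  rw [matchingGraph, SimpleGraph.fromRel_adj]
  constructor
  · rintro ⟨-, h | h⟩
    · exact h
    · rw [← h, (hγ v).1]
  · intro h
    exact ⟨fun huv => (hγ u).2 (h.trans huv.symm), Or.inl h⟩

/-- The sequence `a 0, γ (a 0), a 1, γ (a 1), …`. -/
def interleave (γ : Equiv.Perm V) (a : ℕ → V) (l : ℕ) : V :=
  if Even l then a (l / 2) else γ (a (l / 2))

theorem interleave_two_mul (γ : Equiv.Perm V) (a : ℕ → V) (i : ℕ) :
    interleave γ a (2 * i) = a i := by
  simp [interleave]

theorem interleave_two_mul_add_one (γ : Equiv.Perm V) (a : ℕ → V) (i : ℕ) :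
    interleave γ a (2 * i + 1) = γ (a i) := by
  simp [interleave, show (2 * i + 1) / 2 = i by omega]

open Classical in
theorem exists_interleave_injOn [Fintype V] {τ γ : Equiv.Perm V} (hτ : IsMatchingInvolution τ)
    (hγ : IsMatchingInvolution γ) {m : ℕ} (hm0 : 0 < m) (hm : Fintype.card V = 2 * m) (J : ℕ) :
    ∃ a : ℕ → V, Set.InjOn (interleave γ a) (Set.Iio (2 * m)) ∧
      J * ((Finset.range (m - 1)).filter fun i => a (i + 1) ≠ τ (γ (a i))).card ≤
        2 * m + J * (shortOrbitVertices τ γ J).card := by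
  obtain ⟨A, hnd, hmem, hA⟩ := exists_ordering hτ hγ J
  have hlen : A.length = m := by
    have h1 : (A.flatMap fun v => [v, γ v]).toFinset = Finset.univ := by
      ext v; simpa using hmem v
    have h2 := List.toFinset_card_of_nodup hnd
    rw [h1, Finset.card_univ, hm, List.length_flatMap] at h2
    simp at h2
    omega
  have : Nonempty V := Fintype.card_pos_iff.1 (by omega)
  let x₀ : V := Classical.arbitrary V
  let a : ℕ → V := fun i => A.getD i x₀
  have ha : ∀ i (hi : i < A.length), a i = A[i] := fun i hi => List.getD_eq_getElem A x₀ hi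
  refine ⟨a, ?_, ?_⟩
  · rw [List.nodup_flatMap] at hnd
    have hpw := List.pairwise_iff_getElem.1 hnd.2
    have hlt : ∀ l l', l / 2 < l' / 2 → l' < 2 * m → interleave γ a l ≠ interleave γ a l' := by
      intro l l' hll hl' h
      have hd := hpw (l / 2) (l' / 2) (by omega) (by omega) hll
      rw [← ha _ (by omega), ← ha _ (by omega)] at hd
      have hin : ∀ l, interleave γ a l ∈ [a (l / 2), γ (a (l / 2))] := by
        intro l
        unfold interleave
        split_ifs <;> simp
      exact hd (hin l) (h ▸ hin l')
    intro l hl l' hl' h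
    rw [Set.mem_Iio] at hl hl'
    rcases lt_trichotomy (l / 2) (l' / 2) with hll | hll | hll
    · exact absurd h (hlt l l' hll hl')
    · rcases Nat.even_or_odd' l with ⟨i, rfl | rfl⟩ <;>
      rcases Nat.even_or_odd' l' with ⟨i', rfl | rfl⟩
      · omega
      · rw [interleave_two_mul, interleave_two_mul_add_one, show i' = i by omega] at h
        exact absurd h.symm (hγ _).2
      · rw [interleave_two_mul, interleave_two_mul_add_one, show i' = i by omega] at h
        exact absurd h (hγ _).2
      · omega
    · exact absurd h.symm (hlt l' l hll hl)
  · have hAa : A = (List.range' 0 (m - 1 + 1)).map a := by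
      apply List.ext_getElem
      · simp; omega
      · intro i h1 h2
        simp [ha i h1]
    rw [hAa, breakCount_map_range', zero_add, ← Finset.range_eq_Ico, hm] at hA
    exact hA

variable {m : ℕ}

/-- The permutation of the vertices that permutes the edges of a labelled matching by `π`,
respecting their orientations. -/
def labelPerm (e : V ≃ Fin m × Bool) (π : Equiv.Perm (Fin m)) : Equiv.Perm V :=
  (e.trans (π.prodCongr (Equiv.refl Bool))).trans e.symm

theorem labelPerm_apply (e : V ≃ Fin m × Bool) (π : Equiv.Perm (Fin m)) (v : V) :
    labelPerm e π v = e.symm (π (e v).1, (e v).2) := rfl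

theorem apply_labelPerm {τ : Equiv.Perm V} {e : V ≃ Fin m × Bool}
    (he : ∀ v, e (τ v) = ((e v).1, !(e v).2)) (π : Equiv.Perm (Fin m)) (v : V) :
    τ (labelPerm e π v) = labelPerm e π (τ v) := by
  apply e.injective
  simp [he, labelPerm_apply]

open Classical in
/-- If most edges of `γ` are followed by the `τ`-partner of their end, and the pair counts of the
relabelling `π` are large in the first and in the last third of the ordering, then `H` together with
the relabelled matching is pancyclic. -/
theorem isPancyclic_sup_conj [Fintype V] {H : SimpleGraph V} {τ γ : Equiv.Perm V}
    (hγ : IsMatchingInvolution γ) {e : V ≃ Fin m × Bool}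
    (he : ∀ v, e (τ v) = ((e v).1, !(e v).2)) (hm : Fintype.card V = 2 * m) (hm3 : 3 ≤ m)
    {a : ℕ → V} (ha : Set.InjOn (interleave γ a) (Set.Iio (2 * m))) {R₁ R₂ : ℕ}
    (hR₁ : ((Finset.range (m - 1)).filter fun i => a (i + 1) ≠ τ (γ (a i))).card ≤ R₁)
    (hR₂ : ({v | ¬ H.Adj v (τ v)} : Finset V).card ≤ R₂) (hR : 3 * (R₁ + R₂) < m)
    (π : Equiv.Perm (Fin m))
    (hE : ∀ x y, 3 * (R₁ + R₂) + 3 ≤ pairCount (Finset.range (m / 3)) (fun i => e (a i))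
      (fun i => e (γ (a i))) {z | H.Adj x (e.symm z)} {z | H.Adj y (e.symm z)} π)
    (hF : ∀ x y, 3 * (R₁ + R₂) + 3 ≤ pairCount (Finset.Ico (m - m / 3) m) (fun i => e (a i))
      (fun i => e (γ (a i))) {z | H.Adj x (e.symm z)} {z | H.Adj y (e.symm z)} π) :
    IsPancyclic (H ⊔ matchingGraph (labelPerm e π * γ * (labelPerm e π)⁻¹)) := by
  set ψ := labelPerm e π with hψ
  set Γ := H ⊔ matchingGraph (ψ * γ * ψ⁻¹) with hΓ
  have hγ' := hγ.conj ψ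
  let w : ℕ → V := fun l => ψ (interleave γ a l)
  have hw0 : ∀ i, w (2 * i) = ψ (a i) := fun i => by simp only [w, interleave_two_mul]
  have hw1 : ∀ i, w (2 * i + 1) = ψ (γ (a i)) := fun i => by
    simp only [w, interleave_two_mul_add_one]
  have hw : Set.InjOn w (Set.Iio (2 * m)) := fun x hx y hy h => ha hx hy (ψ.injective h)
  have hedge : ∀ i < m, Γ.Adj (w (2 * i)) (w (2 * i + 1)) := by
    intro i _
    rw [hw0, hw1, hΓ, SimpleGraph.sup_adj, matchingGraph_adj hγ']
    right
    simp
  have hbad : (badLinks (fun i j => Γ.Adj (w i) (w j)) 0 (m - 1)).card ≤ R₁ + R₂ := by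
    have hsub : badLinks (fun i j => Γ.Adj (w i) (w j)) 0 (m - 1) ⊆
        ((Finset.range (m - 1)).filter fun i => a (i + 1) ≠ τ (γ (a i))) ∪
        ((Finset.range (m - 1)).filter fun i => ¬ H.Adj (w (2 * i + 1)) (τ (w (2 * i + 1)))) := by
      intro i hi
      obtain ⟨h1, h2⟩ := mem_badLinks.1 hi
      rw [Finset.mem_union, Finset.mem_filter, Finset.mem_filter, Finset.mem_range]
      by_cases h : a (i + 1) = τ (γ (a i))
      · refine Or.inr ⟨h1.2, fun hadj => h2 ?_⟩
        rw [show 2 * i + 2 = 2 * (i + 1) by ring, hw0, hw1, h, ← apply_labelPerm he, ← hw1]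
        exact Or.inl hadj
      · exact Or.inl ⟨h1.2, h⟩
    refine (Finset.card_le_card hsub).trans ((Finset.card_union_le _ _).trans
      (Nat.add_le_add hR₁ (le_trans ?_ hR₂)))
    refine Finset.card_le_card_of_injOn (fun i => w (2 * i + 1)) ?_ ?_
    · intro i hi
      have hi := (Finset.mem_filter.1 hi).2
      simpa using hi
    · intro i hi j hj hij
      have hi := Finset.mem_range.1 (Finset.mem_filter.1 hi).1
      have hj := Finset.mem_range.1 (Finset.mem_filter.1 hj).1
      have := hw (by rw [Set.mem_Iio]; omega) (by rw [Set.mem_Iio]; omega) hij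
      omega
  obtain ⟨c, hc, hcbad⟩ : ∃ c ∈ Finset.Ico (m / 3) (m - m / 3),
      c ∉ badLinks (fun i j => Γ.Adj (w i) (w j)) 0 (m - 1) := by
    apply Finset.exists_mem_notMem_of_card_lt_card
    rw [Nat.card_Ico]
    omega
  rw [Finset.mem_Ico] at hc
  have hgood : Γ.Adj (w (2 * c + 1)) (w (2 * c + 2)) := by
    by_contra h
    exact hcbad (mem_badLinks.2 ⟨by omega, h⟩)
  obtain ⟨r, hr⟩ : ∃ r : ℕ → ℕ → Prop, r = fun i j => Γ.Adj (w i) (w j) := ⟨_, rfl⟩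
  rw [← hr] at hbad
  intro k hk3 hk
  rw [hm] at hk
  refine HasCyclicList.exists_cycle (w := w) hk3 hw (hr ▸ hasCyclicList_of_ordering (r := r)
    (fun i hi => by rw [hr]; exact hedge i hi) hbad hc.1 hc.2 (by omega) (by rwa [hr]) ?_ ?_ hk3 hk)
  · intro x _ y _
    refine (hE (w x) (w y)).trans (Finset.card_le_card ?_)
    intro i hi
    rw [Finset.mem_filter] at hi ⊢
    obtain ⟨hi, h1, h2⟩ := hi
    rw [hr]
    beta_reduce
    rw [hw0, hw1]
    exact ⟨hi, Or.inl h1, Or.inl h2.symm⟩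
  · intro x _ y _
    refine (hF (w x) (w y)).trans (Finset.card_le_card ?_)
    intro i hi
    rw [Finset.mem_filter] at hi ⊢
    obtain ⟨hi, h1, h2⟩ := hi
    rw [hr]
    beta_reduce
    rw [hw0, hw1]
    exact ⟨hi, Or.inl h1.symm, Or.inl h2⟩

open Classical in
/-- An edge of `γ` inside an edge of the labelled matching is a fixed point of `τ * γ`. -/
theorem card_filter_label_eq_le [Fintype V] {τ γ : Equiv.Perm V} (hτ : IsMatchingInvolution τ)
    (hγ : IsMatchingInvolution γ) {e : V ≃ Fin m × Bool}
    (he : ∀ v, e (τ v) = ((e v).1, !(e v).2)) {a : ℕ → V}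
    {I : Finset ℕ} (ha : Set.InjOn a I) {J : ℕ} (hJ : 0 < J) :
    (I.filter fun i => (e (a i)).1 = (e (γ (a i))).1).card ≤ (shortOrbitVertices τ γ J).card := by
  refine Finset.card_le_card_of_injOn a ?_ (ha.mono fun i hi => (Finset.mem_filter.1 hi).1)
  intro i hi
  have hi := (Finset.mem_filter.1 hi).2
  refine mem_shortOrbitVertices.2 ⟨1, one_pos, hJ, ?_⟩
  rw [pow_one, Equiv.Perm.mul_apply]
  have h : γ (a i) = τ (a i) := by
    apply e.injective
    rw [he]
    refine Prod.ext hi.symm ?_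
    by_contra hne
    apply (hγ (a i)).2
    apply e.injective
    refine Prod.ext hi.symm ?_
    simp only at hne
    cases h1 : (e (γ (a i))).2 <;> cases h2 : (e (a i)).2 <;> simp_all
  rw [h, (hτ _).1]

open Classical in
/-- A set of matching involutions is as frequent among all matching involutions as among the
conjugates of all of them by random relabellings. -/
theorem sum_card_conj_mem [Fintype V] (e : V ≃ Fin m × Bool) (P : Equiv.Perm V → Prop) :
    ∑ γ ∈ matchingInvolutions V, ({π | P (labelPerm e π * γ * (labelPerm e π)⁻¹)} :
      Finset (Equiv.Perm (Fin m))).card =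
      m.factorial * ((matchingInvolutions V).filter P).card := by
  have h := Finset.sum_card_bipartiteAbove_eq_sum_card_bipartiteBelow
      (s := matchingInvolutions V) (t := (Finset.univ : Finset (Equiv.Perm (Fin m))))
      (fun γ π => P (labelPerm e π * γ * (labelPerm e π)⁻¹))
  simp only [Finset.bipartiteAbove, Finset.bipartiteBelow] at h
  rw [h]
  have hconst : ∀ π : Equiv.Perm (Fin m), ((matchingInvolutions V).filter fun γ =>
      P (labelPerm e π * γ * (labelPerm e π)⁻¹)).card = ((matchingInvolutions V).filter P).card := by
    intro π
    refine Finset.card_bij (fun γ _ => labelPerm e π * γ * (labelPerm e π)⁻¹) ?_ ?_ ?_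
    · intro γ hγ
      rw [Finset.mem_filter, mem_matchingInvolutions] at hγ ⊢
      exact ⟨hγ.1.conj _, hγ.2⟩
    · intro γ _ γ' _ h
      exact mul_left_cancel (mul_right_cancel h)
    · intro γ hγ
      rw [Finset.mem_filter, mem_matchingInvolutions] at hγ
      refine ⟨(labelPerm e π)⁻¹ * γ * labelPerm e π, ?_, by group⟩
      rw [Finset.mem_filter, mem_matchingInvolutions]
      refine ⟨by simpa using hγ.1.conj (labelPerm e π)⁻¹, ?_⟩
      have : labelPerm e π * ((labelPerm e π)⁻¹ * γ * labelPerm e π) * (labelPerm e π)⁻¹ = γ := by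
        group
      rw [this]
      exact hγ.2
  rw [Finset.sum_congr rfl fun π _ => hconst π, Finset.sum_const, Finset.card_univ,
    Fintype.card_perm, Fintype.card_fin, smul_eq_mul]

end Conjugation

/-! ### Averaging over relabellings -/

section Averaging

variable {V : Type*} [Fintype V] {m : ℕ} {H : SimpleGraph V} {τ γ : Equiv.Perm V}

open Classical in
/-- For a matching `γ` with few short orbits, most relabellings give a pancyclic union with `H`. -/
theorem card_conj_not_isPancyclic_le (hτ : IsMatchingInvolution τ) (hγ : IsMatchingInvolution γ)
    {e : V ≃ Fin m × Bool} (he : ∀ v, e (τ v) = ((e v).1, !(e v).2))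
    (hm : Fintype.card V = 2 * m) (hm4 : 4 ≤ m) {a J D R₁ R₂ : ℕ} (ha : 1 ≤ a) (hJ : 0 < J)
    (hdeg : ∀ x s, a ≤ ({u | H.Adj x (e.symm (u, s))} : Finset (Fin m)).card)
    (hD : (shortOrbitVertices τ γ J).card ≤ D) (hDm : 24 * D ≤ m)
    (hR₁ : 2 * m + J * D ≤ J * R₁)
    (hR₂ : ({v | ¬ H.Adj v (τ v)} : Finset V).card ≤ R₂) (hR : 3 * (R₁ + R₂) < m) {κ : ℝ}
    (hκ : κ = a * (a - 1) / (16 * m)) (hRκ : 3 * ((R₁ : ℝ) + R₂) + 3 ≤ κ) :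
    (({π | ¬ IsPancyclic (H ⊔ matchingGraph (labelPerm e π * γ * (labelPerm e π)⁻¹))} :
      Finset (Equiv.Perm (Fin m))).card : ℝ) ≤
        8 * m ^ 2 * (m.factorial * Real.exp (-(κ ^ 2 / (512 * m)))) := by
  obtain ⟨b, hb, hbreak⟩ := exists_interleave_injOn hτ hγ (by omega) hm J
  have hbreak' : ((Finset.range (m - 1)).filter fun i => b (i + 1) ≠ τ (γ (b i))).card ≤ R₁ := by
    have h1 := Nat.mul_le_mul_left J hD
    exact Nat.le_of_mul_le_mul_left (by omega) hJ
  set ε := Real.exp (-(κ ^ 2 / (512 * m)))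
  have hb0 : Set.InjOn b (Set.Iio m) := by
    intro i hi j hj hij
    rw [Set.mem_Iio] at hi hj
    have := hb (x₁ := 2 * i) (x₂ := 2 * j) (by rw [Set.mem_Iio]; omega) (by rw [Set.mem_Iio]; omega)
      (by rw [interleave_two_mul, interleave_two_mul, hij])
    omega
  let I : Bool → Finset ℕ := fun s => if s then Finset.range (m / 3) else Finset.Ico (m - m / 3) m
  have hIm : ∀ s, ∀ i ∈ I s, i < m := by
    intro s i hi
    cases s
    · simp [I] at hi; omega
    · simp [I] at hi; omega
  have hIcard : ∀ s, (I s).card = m / 3 := by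
    intro s
    cases s
    · simp [I]; omega
    · simp [I]
  let f : Bool × V × V → Equiv.Perm (Fin m) → ℕ := fun z =>
    pairCount (I z.1) (fun i => e (b i)) (fun i => e (γ (b i))) {v | H.Adj z.2.1 (e.symm v)}
      {v | H.Adj z.2.2 (e.symm v)}
  have htail : ∀ z, (({π | (f z π : ℝ) ≤ κ} : Finset (Equiv.Perm (Fin m))).card : ℝ) ≤
      m.factorial * ε := by
    intro z
    have hinj : Set.InjOn b (I z.1) := hb0.mono fun i hi => hIm _ i hi
    refine card_pairCount_le ha (by omega) (fun i hi j hj h => hinj hi hj (e.injective h))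
      (fun i hi j hj h => hinj hi hj (γ.injective (e.injective h))) (hdeg z.2.1) (hdeg z.2.2) ?_ hκ
    have h1 := (card_filter_label_eq_le hτ hγ he hinj hJ).trans hD
    rw [hIcard]
    have h1' : (((I z.1).filter fun i => (e (b i)).1 = (e (γ (b i))).1).card : ℝ) ≤ D := by
      exact_mod_cast h1
    have h2 : (m : ℝ) ≤ 3 * (m / 3 : ℕ) + 2 := by
      have : m ≤ 3 * (m / 3) + 2 := by omega
      exact_mod_cast this
    have h3 : 24 * (D : ℝ) ≤ m := by exact_mod_cast hDm
    have h4 : (4 : ℝ) ≤ m := by exact_mod_cast hm4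
    linarith
  have hsub : ({π | ¬ IsPancyclic (H ⊔ matchingGraph (labelPerm e π * γ * (labelPerm e π)⁻¹))} :
      Finset (Equiv.Perm (Fin m))) ⊆
      Finset.univ.biUnion fun z => ({π | (f z π : ℝ) ≤ κ} : Finset (Equiv.Perm (Fin m))) := by
    intro π hπ
    by_contra hcon
    simp only [Finset.mem_biUnion, Finset.mem_univ, true_and, Finset.mem_filter, not_exists,
      not_le] at hcon
    refine (Finset.mem_filter.1 hπ).2 ?_
    have hlarge : ∀ z, 3 * (R₁ + R₂) + 3 ≤ f z π := by
      intro z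
      have := hRκ.trans (hcon z).le
      exact_mod_cast this
    exact isPancyclic_sup_conj hγ he hm (by omega) hb hbreak' hR₂ hR π
      (fun x y => hlarge (true, x, y)) (fun x y => hlarge (false, x, y))
  have h1 := (Finset.card_le_card hsub).trans Finset.card_biUnion_le
  calc (_ : ℝ) ≤ ∑ z : Bool × V × V,
        (({π | (f z π : ℝ) ≤ κ} : Finset (Equiv.Perm (Fin m))).card : ℝ) := by exact_mod_cast h1
    _ ≤ ∑ _z : Bool × V × V, m.factorial * ε := Finset.sum_le_sum fun z _ => htail z
    _ = _ := by
      rw [Finset.sum_const, Finset.card_univ, nsmul_eq_mul]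
      simp only [Fintype.card_prod, Fintype.card_bool, hm]
      push_cast
      ring

open Classical in
/-- The proportion of matchings whose union with `H` is not pancyclic. The first term comes from
matchings with many short orbits, the second one from the relabellings of the others. -/
theorem card_not_isPancyclic_le (hτ : IsMatchingInvolution τ)
    {e : V ≃ Fin m × Bool} (he : ∀ v, e (τ v) = ((e v).1, !(e v).2))
    (hm : Fintype.card V = 2 * m) (hm4 : 4 ≤ m) {a J D R₁ R₂ : ℕ} (ha : 1 ≤ a) (hJ : 0 < J)
    (hJm : 4 * J ≤ 2 * m)
    (hdeg : ∀ x s, a ≤ ({u | H.Adj x (e.symm (u, s))} : Finset (Fin m)).card)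
    (hDm : 24 * D ≤ m) (hR₁ : 2 * m + J * D ≤ J * R₁)
    (hR₂ : ({v | ¬ H.Adj v (τ v)} : Finset V).card ≤ R₂) (hR : 3 * (R₁ + R₂) < m) {κ : ℝ}
    (hκ : κ = a * (a - 1) / (16 * m)) (hRκ : 3 * ((R₁ : ℝ) + R₂) + 3 ≤ κ) :
    (((matchingInvolutions V).filter fun γ => ¬ IsPancyclic (H ⊔ matchingGraph γ)).card : ℝ) ≤
      (2 * J / (D + 1) + 8 * m ^ 2 * Real.exp (-(κ ^ 2 / (512 * m)))) *
        (matchingInvolutions V).card := by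
  set ε := Real.exp (-(κ ^ 2 / (512 * m)))
  have hε : 0 < ε := Real.exp_pos _
  set L := (matchingInvolutions V).filter fun γ => D < (shortOrbitVertices τ γ J).card with hL
  have hfac : (0 : ℝ) < m.factorial := by exact_mod_cast m.factorial_pos
  have hLcard : (L.card : ℝ) ≤ 2 * J / (D + 1) * (matchingInvolutions V).card := by
    have h1 : L.card * (D + 1) ≤ 2 * J * (matchingInvolutions V).card := by
      refine le_trans ?_ (sum_card_shortOrbitVertices_le hτ (J := J) (by omega))
      rw [← smul_eq_mul, ← Finset.sum_const]
      exact (Finset.sum_le_sum fun γ hγ => (Finset.mem_filter.1 hγ).2).trans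
        (Finset.sum_le_sum_of_subset (Finset.filter_subset _ _))
    have h2 : (L.card : ℝ) * (D + 1) ≤ 2 * J * (matchingInvolutions V).card := by exact_mod_cast h1
    rw [div_mul_eq_mul_div, le_div_iff₀ (by positivity)]
    exact h2
  have havg : ∑ γ ∈ matchingInvolutions V, ({π | ¬ IsPancyclic (H ⊔ matchingGraph
      (labelPerm e π * γ * (labelPerm e π)⁻¹))} : Finset (Equiv.Perm (Fin m))).card =
      m.factorial * ((matchingInvolutions V).filter fun γ =>
        ¬ IsPancyclic (H ⊔ matchingGraph γ)).card := by
    convert sum_card_conj_mem e (fun γ => ¬ IsPancyclic (H ⊔ matchingGraph γ))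
  have havg' : (m.factorial : ℝ) * ((matchingInvolutions V).filter fun γ =>
      ¬ IsPancyclic (H ⊔ matchingGraph γ)).card ≤ L.card * m.factorial +
        (matchingInvolutions V).card * (8 * m ^ 2 * (m.factorial * ε)) := by
    rw [← Nat.cast_mul, ← havg, Nat.cast_sum]
    calc _ ≤ ∑ γ ∈ matchingInvolutions V, ((if γ ∈ L then (m.factorial : ℝ) else 0) +
          8 * m ^ 2 * (m.factorial * ε)) := by
          refine Finset.sum_le_sum fun γ hγ => ?_
          by_cases hγL : γ ∈ L
          · rw [if_pos hγL]
            have h1 := Finset.card_le_univ ({π | ¬ IsPancyclic (H ⊔ matchingGraph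
              (labelPerm e π * γ * (labelPerm e π)⁻¹))} : Finset (Equiv.Perm (Fin m)))
            rw [Fintype.card_perm, Fintype.card_fin] at h1
            have h2 : (0 : ℝ) ≤ 8 * m ^ 2 * (m.factorial * ε) := by positivity
            have h3 := (Nat.cast_le (α := ℝ)).2 h1
            linarith
          · rw [if_neg hγL, zero_add]
            have hD : (shortOrbitVertices τ γ J).card ≤ D := by
              by_contra h
              exact hγL (Finset.mem_filter.2 ⟨hγ, not_le.1 h⟩)
            exact card_conj_not_isPancyclic_le hτ (mem_matchingInvolutions.1 hγ) he hm hm4 ha hJ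
              hdeg hD hDm hR₁ hR₂ hR hκ hRκ
      _ = _ := by
          rw [Finset.sum_add_distrib, Finset.sum_const, nsmul_eq_mul, ← Finset.sum_filter,
            Finset.sum_const, nsmul_eq_mul]
          congr 3
          congr 1
          rw [Finset.filter_mem_eq_inter, Finset.inter_eq_right]
          exact Finset.filter_subset _ _
  have h5 : (m.factorial : ℝ) * ((matchingInvolutions V).filter fun γ =>
      ¬ IsPancyclic (H ⊔ matchingGraph γ)).card ≤ m.factorial *
        (L.card + (matchingInvolutions V).card * (8 * m ^ 2 * ε)) :=
    havg'.trans_eq (by ring)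
  have h6 := le_of_mul_le_mul_left h5 hfac
  calc _ ≤ (L.card : ℝ) + (matchingInvolutions V).card * (8 * m ^ 2 * ε) := h6
    _ ≤ 2 * J / (D + 1) * (matchingInvolutions V).card +
        (matchingInvolutions V).card * (8 * m ^ 2 * ε) := by gcongr
    _ = _ := by ring

end Averaging

/-! ### Regular graphs of degree one and matching involutions -/

section RegularGraph

variable {V : Type*}

theorem matchingGraph_isRegularOfDegree {γ : Equiv.Perm V} (hγ : IsMatchingInvolution γ)
    [(matchingGraph γ).LocallyFinite] : (matchingGraph γ).IsRegularOfDegree 1 := by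
  intro v
  rw [SimpleGraph.degree_eq_one_iff_existsUnique_adj]
  exact ⟨γ v, (matchingGraph_adj hγ).2 rfl, fun u hu => ((matchingGraph_adj hγ).1 hu).symm⟩

theorem exists_matchingGraph_eq {G : SimpleGraph V} [G.LocallyFinite]
    (hG : G.IsRegularOfDegree 1) : ∃ γ, IsMatchingInvolution γ ∧ matchingGraph γ = G := by
  have hex : ∀ v, ∃! u, G.Adj v u := fun v =>
    SimpleGraph.degree_eq_one_iff_existsUnique_adj.1 (hG v)
  choose f hf hfu using hex
  have hinv : Function.Involutive f := fun v => (hfu (f v) v (hf v).symm).symm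
  have hγ : IsMatchingInvolution (hinv.toPerm f) := fun v => ⟨hinv v, (hf v).ne.symm⟩
  refine ⟨hinv.toPerm f, hγ, ?_⟩
  ext u v
  rw [matchingGraph_adj hγ]
  constructor
  · rintro rfl
    exact hf u
  · intro h
    exact (hfu u v h).symm

theorem matchingGraph_injOn : Set.InjOn (matchingGraph (V := V)) {γ | IsMatchingInvolution γ} := by
  intro γ hγ γ' hγ' h
  ext v
  have : (matchingGraph γ').Adj v (γ v) := h ▸ (matchingGraph_adj hγ).2 rfl
  exact ((matchingGraph_adj hγ').1 this).symm

open Classical in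
/-- Counting 1-regular graphs amounts to counting matching involutions. -/
theorem card_filter_isRegularOfDegree_one {n : ℕ} (P : SimpleGraph (Fin n) → Prop) :
    Finset.card {G : SimpleGraph (Fin n) | G.IsRegularOfDegree 1 ∧ P G} =
      ((matchingInvolutions (Fin n)).filter fun γ => P (matchingGraph γ)).card := by
  symm
  refine Finset.card_bij (fun γ _ => matchingGraph γ) ?_ ?_ ?_
  · intro γ hγ
    rw [Finset.mem_filter, mem_matchingInvolutions] at hγ
    simpa using ⟨matchingGraph_isRegularOfDegree hγ.1, hγ.2⟩
  · intro γ hγ γ' hγ' h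
    rw [Finset.mem_filter, mem_matchingInvolutions] at hγ hγ'
    exact matchingGraph_injOn hγ.1 hγ'.1 h
  · intro G hG
    have hG' : G.IsRegularOfDegree 1 ∧ P G := by simpa using hG
    obtain ⟨γ, hγ, rfl⟩ := exists_matchingGraph_eq hG'.1
    exact ⟨γ, Finset.mem_filter.2 ⟨mem_matchingInvolutions.2 hγ, hG'.2⟩, rfl⟩

open Classical in
/-- A lower bound for the probability that the random 1-regular graph has a property, from an upper
bound for the number of matching involutions without it. -/
theorem one_sub_le_randomRegularGraph_one {n : ℕ} (hn : Even n)
    (P : SimpleGraph (Fin n) → Prop) {η : ℝ}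
    (h : (((matchingInvolutions (Fin n)).filter fun γ => ¬ P (matchingGraph γ)).card : ℝ) ≤
      η * (matchingInvolutions (Fin n)).card) :
    ENNReal.ofReal (1 - η) ≤ randomRegularGraph n 1 {G | P G} := by
  obtain ⟨σ, hσ⟩ := exists_isMatchingInvolution (α := Fin n) (by simpa using hn)
  have hpos : 0 < (matchingInvolutions (Fin n)).card :=
    Finset.card_pos.2 ⟨σ, mem_matchingInvolutions.2 hσ⟩
  have hpos' : (0 : ℝ) < (matchingInvolutions (Fin n)).card := by exact_mod_cast hpos
  rw [randomRegularGraph_apply]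
  have h1 := card_filter_isRegularOfDegree_one P
  have h2 := card_filter_isRegularOfDegree_one (n := n) (fun _ => True)
  simp only [and_true, Finset.filter_true] at h2
  simp only [Set.mem_ofPred_eq]
  rw [h1, h2, ← ENNReal.ofReal_natCast, ← ENNReal.ofReal_natCast,
    ← ENNReal.ofReal_div_of_pos hpos']
  apply ENNReal.ofReal_le_ofReal
  rw [le_div_iff₀ hpos']
  have h3 := Finset.card_filter_add_card_filter_not (s := matchingInvolutions (Fin n))
    (fun γ => P (matchingGraph γ))
  have h3' : (((matchingInvolutions (Fin n)).filter fun γ => P (matchingGraph γ)).card : ℝ) +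
      ((matchingInvolutions (Fin n)).filter fun γ => ¬ P (matchingGraph γ)).card =
      (matchingInvolutions (Fin n)).card := by exact_mod_cast h3
  linarith

end RegularGraph

/-! ### The asymptotic estimate -/

section Asymptotic

open Classical in
theorem randomRegularGraph_le_one (n d : ℕ) (S : Set (SimpleGraph (Fin n))) :
    randomRegularGraph n d S ≤ 1 := by
  rw [randomRegularGraph_apply]
  refine ENNReal.div_le_of_le_mul ?_
  rw [one_mul, Nat.cast_le]
  exact Finset.card_le_card fun G hG => by
    rw [Finset.mem_filter] at hG ⊢
    exact ⟨hG.1, hG.2.1⟩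

open Classical in
/-- The quantitative form of the theorem, for a single graph. With `β = α² n`, orbits count as short
up to length `√n`; with high probability there are at most `β / 3000` bad links, and every pair count
is at least `β / 256`. -/
theorem card_not_isPancyclic_le_of_large {n : ℕ} (hn_even : Even n) (hn : 16 ≤ n)
    {α : ℝ} (hα : 0 ≤ α) (H : SimpleGraph (Fin n)) (hH : α * n ≤ H.minDegree) (M : H.Subgraph)
    (hM : M.IsMatching) (hcover : (n : ℝ) - M.verts.ncard ≤ α ^ 2 * n / 10 ^ 4)
    (hlog : 1 ≤ Real.log n) (hlarge : 10 ^ 9 * (n * Real.log n) ≤ (α ^ 2 * n) ^ 2) :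
    (((matchingInvolutions (Fin n)).filter fun γ =>
      ¬ IsPancyclic (H ⊔ matchingGraph γ)).card : ℝ) ≤
      (1 / √(Real.log n) + 2 / n) * (matchingInvolutions (Fin n)).card := by
  obtain ⟨m, hm⟩ := even_iff_exists_two_mul.1 hn_even
  have hcard : Fintype.card (Fin n) = 2 * m := by simpa using hm
  have hnm : (n : ℝ) = 2 * m := by exact_mod_cast hm
  have hn' : (16 : ℝ) ≤ n := by exact_mod_cast hn
  have hn0 : (0 : ℝ) < n := by linarith
  have hm0 : (0 : ℝ) < m := by linarith
  set l := Real.log n with hl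
  set β := α ^ 2 * n with hβ
  set s := √(n : ℝ) with hs
  have hs2 : s * s = n := Real.mul_self_sqrt hn0.le
  have hs4 : 4 ≤ s := Real.le_sqrt_of_sq_le (by linarith)
  have hβ0 : 0 ≤ β := by positivity
  have hln : l ≤ n := (Real.log_le_sub_one_of_pos hn0).trans (by linarith)
  have hβs : 30000 * s ≤ β := by
    refine le_of_sq_le_sq ?_ hβ0
    have h1 : (n : ℝ) ≤ n * l := le_mul_of_one_le_right hn0.le hlog
    rw [show (30000 * s) ^ 2 = 9 * 10 ^ 8 * (s * s) by ring, hs2]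
    linarith only [h1, hlarge, hn0]
  have hβl : 30000 * l ≤ β := by
    refine le_of_sq_le_sq ?_ hβ0
    have h1 : l * l ≤ n * l := mul_le_mul_of_nonneg_right hln (by linarith only [hlog])
    have h2 : 0 ≤ n * l := mul_nonneg hn0.le (by linarith only [hlog])
    rw [show (30000 * l) ^ 2 = 9 * 10 ^ 8 * (l * l) by ring]
    linarith only [h1, h2, hlarge]
  have hα1 : α ≤ 1 := by
    have : Nonempty (Fin n) := ⟨⟨0, by omega⟩⟩
    have h1 : H.minDegree ≤ n := by
      simpa using (H.minDegree_lt_card).le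
    have h2 : (H.minDegree : ℝ) ≤ n := by exact_mod_cast h1
    refine le_of_mul_le_mul_right ?_ hn0
    linarith only [h2, hH]
  have hβd : β ≤ α * n := by
    rw [hβ, sq, mul_assoc]
    exact mul_le_of_le_one_left (mul_nonneg hα hn0.le) hα1
  have hβn : β ≤ n := hβd.trans (mul_le_of_le_one_left hn0.le hα1)
  obtain ⟨τ, hτ, hτM⟩ := hM.exists_isMatchingInvolution (by simpa using hn_even)
  -- orientation of the extended matching
  have hexp : ∀ x : ℝ, 2 * l ≤ x → Real.exp (-x) ≤ 1 / (n : ℝ) ^ 2 := by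
    intro x hx
    have : Real.exp (-x) ≤ Real.exp (-(2 * l)) := Real.exp_le_exp.2 (by linarith)
    refine this.trans_eq ?_
    rw [Real.exp_neg, mul_comm, Real.exp_mul, Real.exp_log hn0]
    simp
  have hd2 : (α * n) ^ 2 / (8 * m) = β / 4 := by
    rw [hβ, show (8 : ℝ) * m = 4 * n by rw [hnm]; ring]
    field_simp
  obtain ⟨e, he, hNe⟩ := hτ.exists_balanced_labelling hcard (fun x => {v | H.Adj x v})
    (d := α * n) (by positivity)
    (fun x => by
      refine hH.trans ?_
      have h1 : ({v | v ∈ ({v | H.Adj x v} : Set (Fin n))} : Finset (Fin n)).card = H.degree x := by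
        rw [← SimpleGraph.card_neighborFinset_eq_degree, SimpleGraph.neighborFinset_eq_filter]
        congr
      rw [h1]
      exact_mod_cast H.minDegree_le_degree x)
    (by
      rw [hd2]
      have h1 := hexp (β / 4) (by linarith)
      calc 4 * (m : ℝ) * Real.exp (-(β / 4)) ≤ 4 * m * (1 / (n : ℝ) ^ 2) := by gcongr
        _ = 2 / n := by rw [show (4 : ℝ) * m = 2 * n by rw [hnm]; ring]; field_simp
        _ < 1 := by rw [div_lt_one hn0]; linarith)
  have hα8 : 8 ≤ α * n := by linarith
  set a := ⌈α * n / 4⌉₊ with ha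
  have haR : α * n / 4 ≤ a := Nat.le_ceil _
  have ha1 : 1 ≤ a := Nat.one_le_ceil_iff.2 (by linarith)
  set J := Nat.sqrt n with hJ
  have hJs : (J : ℝ) ≤ s := Real.nat_sqrt_le_real_sqrt
  have hJs' : s ≤ J + 1 := Real.real_sqrt_le_nat_sqrt_succ
  have hJ0 : 0 < J := Nat.sqrt_pos.2 (by omega)
  have hJ0' : (0 : ℝ) < J := by exact_mod_cast hJ0
  set D := ⌊β / 10 ^ 4⌋₊ with hD
  have hDβ : (D : ℝ) ≤ β / 10 ^ 4 := Nat.floor_le (by positivity)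
  have hDβ' : β / 10 ^ 4 < D + 1 := Nat.lt_floor_add_one _
  set R₂ := ({v | ¬ H.Adj v (τ v)} : Finset (Fin n)).card with hR₂
  have hR₂β : (R₂ : ℝ) ≤ β / 10 ^ 4 := by
    rw [Fintype.card_fin] at hτM
    have : (R₂ : ℝ) + M.verts.ncard ≤ n := by exact_mod_cast hτM
    linarith
  have hnJ : ((n / J : ℕ) : ℝ) ≤ 2 * s := by
    refine Nat.cast_div_le.trans ?_
    rw [div_le_iff₀ hJ0', ← hs2]
    have h1 : s * s ≤ s * (2 * J) :=
      mul_le_mul_of_nonneg_left (by linarith only [hJs', hs4]) (by linarith only [hs4])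
    linarith only [h1]
  have hRR : 3 * (((D + (n / J + 1) : ℕ) : ℝ) + R₂) + 3 ≤ β / 1000 := by
    push_cast
    linarith only [hDβ, hR₂β, hnJ, hβs, hs4]
  set κ : ℝ := a * (a - 1) / (16 * m) with hκ
  have hκβ : β / 256 ≤ κ := by
    have h1 : α * n / 8 ≤ a - 1 := by linarith
    have h2 : (α * n / 4) * (α * n / 8) ≤ a * (a - 1) := by gcongr
    rw [hκ, le_div_iff₀ (by positivity)]
    refine le_trans (le_of_eq ?_) h2
    rw [hβ, show (16 : ℝ) * m = 8 * n by rw [hnm]; ring]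
    ring
  have hκ2 : 3 * l ≤ κ ^ 2 / (512 * m) := by
    rw [show (512 : ℝ) * m = 256 * n by rw [hnm]; ring, le_div_iff₀ (by positivity)]
    have h1 : (β / 256) ^ 2 ≤ κ ^ 2 := by gcongr
    have h2 : 0 ≤ n * l := mul_nonneg hn0.le (by linarith only [hlog])
    have h3 : (β / 256) ^ 2 = β ^ 2 / 65536 := by ring
    rw [h3] at h1
    linarith only [h1, h2, hlarge]
  have hJn : 4 * J ≤ n := by
    have h1 : 4 * s ≤ s * s := mul_le_mul_of_nonneg_right hs4 (by linarith only [hs4])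
    have : 4 * (J : ℝ) ≤ n := by linarith only [h1, hs2, hJs]
    exact_mod_cast this
  have key := card_not_isPancyclic_le (H := H) hτ he hcard (by omega) ha1 hJ0 (by omega)
    (fun x t => Nat.ceil_le.2 (by
      exact hNe x t)) (D := D) (R₁ := D + (n / J + 1)) (R₂ := R₂)
    (by
      have : 24 * (D : ℝ) ≤ m := by linarith
      exact_mod_cast this)
    (by
      have := Nat.div_add_mod n J
      have := Nat.mod_lt n hJ0
      rw [mul_add, mul_add, mul_one]
      omega)
    le_rfl
    (by
      have : 3 * (((D + (n / J + 1) : ℕ) : ℝ) + R₂) < m := by linarith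
      exact_mod_cast this)
    hκ (by linarith)
  refine key.trans (mul_le_mul_of_nonneg_right (add_le_add ?_ ?_) (Nat.cast_nonneg _))
  · have hl0 : 0 < √l := Real.sqrt_pos.2 (by linarith)
    have hsl : 30000 * (s * √l) ≤ β := by
      refine le_of_sq_le_sq ?_ hβ0
      have : (s * √l) ^ 2 = n * l := by
        rw [mul_pow, sq s, hs2, Real.sq_sqrt (by linarith only [hlog])]
      rw [mul_pow, this]
      have h2 : 0 ≤ n * l := mul_nonneg hn0.le (by linarith only [hlog])
      linarith only [h2, hlarge]
    rw [div_le_div_iff₀ (by positivity) hl0]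
    have h3 : (J : ℝ) * √l ≤ s * √l := mul_le_mul_of_nonneg_right hJs hl0.le
    linarith only [h3, hsl, hDβ']
  · have h1 : Real.exp (-(κ ^ 2 / (512 * m))) ≤ 1 / (n : ℝ) ^ 3 := by
      have : Real.exp (-(κ ^ 2 / (512 * m))) ≤ Real.exp (-(3 * l)) := Real.exp_le_exp.2 (by linarith)
      refine this.trans_eq ?_
      rw [Real.exp_neg, mul_comm, Real.exp_mul, Real.exp_log hn0]
      simp
    calc 8 * (m : ℝ) ^ 2 * Real.exp (-(κ ^ 2 / (512 * m)))
        ≤ 8 * (m : ℝ) ^ 2 * (1 / (n : ℝ) ^ 3) := by gcongr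
      _ = 2 / (n : ℝ) := by
        rw [show 8 * (m : ℝ) ^ 2 = 2 * n ^ 2 by rw [hnm]; ring]
        field_simp

end Asymptotic

theorem theorem1p3
    (n : ℕ → ℕ) (hn : Tendsto n atTop atTop) (hn_even : ∀ i, Even (n i))
    (α : ℕ → ℝ) (hα_nonneg : ∀ i, 0 ≤ α i)
    (hα : (fun i => (Real.log (n i) / (n i : ℝ)) ^ (1 / 4 : ℝ)) =o[atTop] α)
    (H : (i : ℕ) → SimpleGraph (Fin (n i))) [∀ i, DecidableRel (H i).Adj]
    (hH : ∀ i, α i * (n i : ℝ) ≤ ((H i).minDegree : ℝ))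
    (M : (i : ℕ) → (H i).Subgraph) (hM : ∀ i, (M i).IsMatching)
    (hM_cover : (fun i => (n i : ℝ) - ((M i).verts.ncard : ℝ)) =o[atTop]
      fun i => α i ^ 2 * (n i : ℝ)) :
    Tendsto (fun i => randomRegularGraph (n i) 1 {G | IsPancyclic (H i ⊔ G)})
      atTop (nhds 1) := by
  have hnR : Tendsto (fun i => (n i : ℝ)) atTop atTop := tendsto_natCast_atTop_atTop.comp hn
  have hlog : Tendsto (fun i => Real.log (n i)) atTop atTop := Real.tendsto_log_atTop.comp hnR
  have hη : Tendsto (fun i => 1 / √(Real.log (n i)) + 2 / (n i : ℝ)) atTop (nhds 0) := by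
    have h1 : Tendsto (fun i => 1 / √(Real.log (n i))) atTop (nhds 0) :=
      (Real.tendsto_sqrt_atTop.comp hlog).const_div_atTop 1
    simpa using h1.add (hnR.const_div_atTop 2)
  have hlower : Tendsto
      (fun i => ENNReal.ofReal (1 - (1 / √(Real.log (n i)) + 2 / (n i : ℝ)))) atTop (nhds 1) := by
    have := ENNReal.tendsto_ofReal (hη.const_sub 1)
    simpa using this
  have hbound : ∀ᶠ i in atTop, ENNReal.ofReal (1 - (1 / √(Real.log (n i)) + 2 / (n i : ℝ))) ≤
      randomRegularGraph (n i) 1 {G | IsPancyclic (H i ⊔ G)} := by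
    filter_upwards [hn.eventually_ge_atTop 16, hlog.eventually_ge_atTop 1,
      hα.def (c := 1 / 200) (by norm_num), hM_cover.def (c := 1 / 10 ^ 4) (by norm_num)]
      with i h16 hlog1 hαi hMi
    have hn0 : (0 : ℝ) < n i := by
      have : 0 < n i := by omega
      exact_mod_cast this
    refine one_sub_le_randomRegularGraph_one (hn_even i) _ ?_
    have hlarge : 10 ^ 9 * ((n i : ℝ) * Real.log (n i)) ≤ (α i ^ 2 * n i) ^ 2 := by
      have hq : 0 ≤ Real.log (n i) / (n i : ℝ) := by positivity
      rw [Real.norm_of_nonneg (by positivity), Real.norm_of_nonneg (hα_nonneg i)] at hαi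
      have h4 := pow_le_pow_left₀ (by positivity) hαi 4
      rw [← Real.rpow_natCast, ← Real.rpow_mul hq] at h4
      norm_num at h4
      rw [div_le_iff₀ hn0] at h4
      have h5 : (n i : ℝ) * Real.log (n i) ≤ n i * ((1 / 200 * α i) ^ 4 * n i) := by
        refine mul_le_mul_of_nonneg_left ?_ hn0.le
        convert h4 using 2
      have h6 : 0 ≤ α i ^ 4 * (n i : ℝ) ^ 2 := by positivity
      nlinarith
    have hcov : (n i : ℝ) - (M i).verts.ncard ≤ α i ^ 2 * n i / 10 ^ 4 := by
      have h := (le_abs_self _).trans hMi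
      rw [Real.norm_of_nonneg (by positivity)] at h
      linarith
    convert card_not_isPancyclic_le_of_large (hn_even i) h16 (hα_nonneg i) (H i) ?_ (M i) (hM i)
      hcov hlog1 hlarge using 1
    convert hH i
  refine tendsto_of_tendsto_of_tendsto_of_le_of_le' hlower tendsto_const_nhds hbound ?_
  exact Eventually.of_forall fun i => randomRegularGraph_le_one _ _ _
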